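/- Let $(X,\mathscr X,\mu,T)$ be an invertible probability preserving system, let $E\in\mathscr X$ sweep out $X$, i.e. $\mu\big(\bigcup_{n\ge0}T^{-n}E\big)=1$, and let $\mathcal Q=\{Q_1,\dots,Q_t\}$ be a finite measurable partition of $X$. Write $\mu_E=\mu(\cdot)/\mu(E)$ for the induced measure on $E$, $r_E(x)=\min\{n\ge1:T^nx\in E\}$ for the return time, $T_E(x)=T^{r_E(x)}(x)$ for the induced map, and let $\mathcal E=\{E_n\}_{n\in\mathbb N\cup\{\infty\}}$ be the entry-time partition of $E$, $E_n=\{y\in E: r_E(T_E^{-1}y)=n\}$ (so that $n$ is the time elapsed since the previous visit to $E$). Put $\hat{\mathcal Q}=\mathcal Q\vee\{E,X\setminus E\}$, and let $\hat{\mathcal P}_E^{\mathcal Q}$ be the partition of $E$ obtained by refining each $E_n$, $n<\infty$, according to $\bigvee_{-n<j\le0}T^{-j}\hat{\mathcal Q}$ (the null cell $E_\infty$ is left as it is). For a countable measurable partition $\mathcal P$ with respect to a probability measure $\nu$ let $H_\nu(\mathcal P)=-\sum_{P\in\mathcal P}\nu(P)\log\nu(P)$ be its static entropy and $h_\nu(S,\mathcal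 P)=\lim_{n}\frac1nH_\nu\big(\bigvee_{j=0}^{n-1}S^{-j}\mathcal P\big)$ its dynamical entropy with respect to a map $S$. The process $(T,\mathcal P)$ is the sequence $(\mathcal P\circ T^i)_{i\in\mathbb Z}$, where $\mathcal P(x)$ is the label of the cell containing $x$. Two stationary processes with countable alphabets $A,B$ and laws $\nu$ on $A^{\mathbb Z}$, $\nu'$ on $B^{\mathbb Z}$ are finitarily isomorphic if there are measurable, a.e. shift-equivariant maps $\varphi:A^{\mathbb Z}\to B^{\mathbb Z}$ and $\psi:B^{\mathbb Z}\to A^{\mathbb Z}$ with $\varphi_*\nu=\nu'$, $\psi_*\nu'=\nu$, inverse to each other a.e., and both finitary: for a.e. $x$ there is $n$ such that $\varphi(y)_0=\varphi(x)_0$ for a.e. $y$ with $y_i=x_i$ for all $|i|\le n$, and likewise for $\psi$. Then: 1. $\hat{\mathcal P}_E^{\mathcal Q}$ is a countable measurable partition of $E$ that refines $\mathcal E$; 2. $H_{\mu_E}(\hat{\mathcal P}_E^{\mathcal Q})<\infty$; 3. the processes $(T,\hat{\mathcal P}_E^{\mathcal Q}\cup\{X\setminus E\})$ and $(T,\hat{\mathcal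 Q})$ are finitarily isomorphic; 4. the limits defining $h_{\mu_E}(T_E,\hat{\mathcal P}_E^{\mathcal Q})$ and $h_\mu(T,\hat{\mathcal Q})$ exist, the latter is finite, and $$\mu(E)\,h_{\mu_E}(T_E,\hat{\mathcal P}_E^{\mathcal Q})=h_\mu(T,\hat{\mathcal Q}).$$ -/

import Mathlib

open MeasureTheory Filter Topology
open scoped ENNReal

noncomputable section

namespace AdaptedPartition

/-! A countable measurable partition of a measurable space `X` is given by its labelling map
`P : X → Λ` into a countable discrete alphabet `Λ`; its cells are the sets `P ⁻¹' {a}`, and `P x` is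
the label of the cell that contains `x`. Some labels may name empty cells. -/

/-- `P` refines `R`: every cell of `P` lies in a cell of `R`. -/
def Refines {X Λ Λ' : Type*} (P : X → Λ) (R : X → Λ') : Prop :=
  ∀ a : Λ, ∃ b : Λ', P ⁻¹' {a} ⊆ R ⁻¹' {b}

/-! ### Static and dynamical entropy -/

/-- The static entropy `H_μ(P) = - ∑ μ(A) log μ(A)`, the sum taken over the cells `A` of `P`, with
values in `[0, ∞]`. Here `Real.negMulLog t = - t * log t`, with value `0` at `0`. -/
def staticEntropy {X Λ : Type*} [MeasurableSpace X] (μ : Measure X) (P : X → Λ) : ℝ≥0∞ :=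
  ∑' a : Λ, ENNReal.ofReal (Real.negMulLog (μ.real (P ⁻¹' {a})))

/-- The join `Pⁿ = P ∨ T⁻¹ P ∨ ⋯ ∨ T⁻⁽ⁿ⁻¹⁾ P`. -/
def join {X Λ : Type*} (T : X → X) (P : X → Λ) (n : ℕ) : X → (Fin n → Λ) :=
  fun x j => P (T^[j] x)

/-- The sequence `H_μ(Pⁿ) / n`. -/
def entropyRate {X Λ : Type*} [MeasurableSpace X] (μ : Measure X) (T : X → X) (P : X → Λ)
    (n : ℕ) : ℝ≥0∞ :=
  staticEntropy μ (join T P n) / n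

/-- The dynamical entropy `h_μ(T, P) = lim H_μ(Pⁿ) / n`. -/
def dynEntropy {X Λ : Type*} [MeasurableSpace X] (μ : Measure X) (T : X → X) (P : X → Λ) : ℝ≥0∞ :=
  limUnder atTop (entropyRate μ T P)

/-! ### Sweeping out, return times, the induced system -/

/-- `E` sweeps out: almost every point of `X` belongs to some `T⁻ⁿ E` with `n ≥ 0`. -/
def SweepsOut {X : Type*} [MeasurableSpace X] (μ : Measure X) (T : X → X) (E : Set X) : Prop :=
  μ (⋃ n : ℕ, T^[n] ⁻¹' E) = 1

open Classical in
/-- The return time `r_E(x) = min {n ≥ 1 : Tⁿ x ∈ E}`, with `min ∅ = ∞`. -/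
def returnTime {X : Type*} (T : X → X) (E : Set X) (x : X) : ℕ∞ :=
  if h : ∃ n : ℕ, 1 ≤ n ∧ T^[n] x ∈ E then (Nat.find h : ℕ∞) else ⊤

theorem returnTime_eq_coe_iff {X : Type*} {T : X → X} {E : Set X} {x : X} {n : ℕ} :
    returnTime T E x = n ↔
      (1 ≤ n ∧ T^[n] x ∈ E) ∧ ∀ m < n, ¬ (1 ≤ m ∧ T^[m] x ∈ E) := by
  classical
  unfold returnTime
  split_ifs with h
  · rw [Nat.cast_inj, Nat.find_eq_iff]
  · refine ⟨fun h' => absurd h' (by simp), fun h' => absurd ⟨n, h'.1⟩ h⟩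

theorem iterate_returnTime_mem {X : Type*} (T : X → X) (E : Set X) {x : X} (hx : x ∈ E) :
    T^[(returnTime T E x).toNat] x ∈ E := by
  cases h : returnTime T E x with
  | top => simpa using hx
  | coe n => exact (returnTime_eq_coe_iff.1 h).1.2

/-- The induced map `T_E(x) = T^{r_E(x)}(x)` on `E`. Points that never return are fixed. -/
def inducedMap {X : Type*} (T : X → X) (E : Set X) : E → E :=
  fun x => ⟨T^[(returnTime T E x).toNat] x, iterate_returnTime_mem T E x.2⟩

/-- The induced measure `μ_E(A) = μ(A) / μ(E)` on `E`. -/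
def inducedMeasure {X : Type*} [MeasurableSpace X] (μ : Measure X) (E : Set X) : Measure E :=
  (μ E)⁻¹ • μ.comap Subtype.val

/-! ### The entry-time partition and the adapted partition -/

/-- The entry-time partition of `E`. The label of `y ∈ E` is the time
`r_E(T_E⁻¹ y) = min {n ≥ 1 : T⁻ⁿ y ∈ E}` since the previous visit to `E`, see
`entryTime_eq_coe_iff`. The cells are the sets `E_n`, for `n` finite or `∞`. -/
def entryTime {X : Type*} [MeasurableSpace X] (T : X ≃ᵐ X) (E : Set X) : E → ℕ∞ :=
  fun y => returnTime T.symm E y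

/-- For finite `n` the cell `E_n` is the set of all `y` with `y = T_E x` and `r_E(x) = n` for some
`x ∈ E`. -/
theorem entryTime_eq_coe_iff {X : Type*} [MeasurableSpace X] (T : X ≃ᵐ X) (E : Set X) (y : E)
    (n : ℕ) :
    entryTime T E y = n ↔ ∃ x : E, inducedMap T E x = y ∧ returnTime T E x = n := by
  have hl : Function.LeftInverse T.symm T := T.symm_apply_apply
  have hr : Function.RightInverse T.symm T := T.apply_symm_apply
  unfold entryTime
  constructor
  · intro h
    obtain ⟨⟨h1, hE⟩, hmin⟩ := returnTime_eq_coe_iff.1 h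
    have key : ∀ m ≤ n, T^[m] (T.symm^[n] y) = T.symm^[n - m] y := by
      intro m hm
      conv_lhs => rw [← Nat.add_sub_cancel' hm, Function.iterate_add_apply]
      exact hr.iterate m _
    have hret : returnTime T E (T.symm^[n] y) = n := by
      rw [returnTime_eq_coe_iff]
      refine ⟨⟨h1, by rw [key n le_rfl]; simp⟩, fun m hm hm' => ?_⟩
      refine hmin (n - m) (by omega) ⟨by omega, ?_⟩
      rw [← key m hm.le]
      exact hm'.2
    refine ⟨⟨_, hE⟩, Subtype.ext ?_, hret⟩
    simp only [inducedMap, hret, ENat.toNat_natCast]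
    rw [key n le_rfl]
    simp
  · rintro ⟨x, rfl, h⟩
    obtain ⟨⟨h1, hE⟩, hmin⟩ := returnTime_eq_coe_iff.1 h
    have key : ∀ m ≤ n, T.symm^[m] (T^[n] x) = T^[n - m] x := by
      intro m hm
      conv_lhs => rw [← Nat.add_sub_cancel' hm, Function.iterate_add_apply]
      exact hl.iterate m _
    simp only [inducedMap, h, ENat.toNat_natCast]
    rw [returnTime_eq_coe_iff]
    refine ⟨⟨h1, by rw [key n le_rfl]; simp⟩, fun m hm hm' => ?_⟩
    refine hmin (n - m) (by omega) ⟨by omega, ?_⟩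
    rw [← key m hm.le]
    exact hm'.2

open Classical in
/-- The partition `Q̂ = Q ∨ {E, X ∖ E}`. The symbol `(q, true)` is the starred symbol `q*`, which
names `Q_q ∩ E`, and `(q, false)` names `Q_q ∖ E`. -/
def hatPartition {X κ : Type*} (E : Set X) (Q : X → κ) : X → κ × Bool :=
  fun x => (Q x, decide (x ∈ E))

/-- Labels of the cells of the adapted partition: finite words over the alphabet of `Q̂`. -/
def Block (κ : Type*) : Type _ := List (κ × Bool)

/-- The alphabet `Block κ ∪ {0}`; the extra symbol `0`, written `none`, names `X ∖ E`. -/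
def ExtBlock (κ : Type*) : Type _ := Option (List (κ × Bool))

instance (κ : Type*) [Countable κ] : Countable (Block κ) :=
  inferInstanceAs (Countable (List (κ × Bool)))

instance (κ : Type*) [Countable κ] : Countable (ExtBlock κ) :=
  inferInstanceAs (Countable (Option (List (κ × Bool))))

instance (κ : Type*) : MeasurableSpace (Block κ) := ⊤

instance (κ : Type*) : MeasurableSpace (ExtBlock κ) := ⊤

/-- The partition of `E` adapted to the entry-time partition and to `Q`: for finite `n` the cell
`E_n` is refined by `⋁_{-n < j ≤ 0} T^{-j} Q̂`, that is, the label of `y ∈ E_n` is the word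
`Q̂(y), Q̂(T⁻¹ y), …, Q̂(T^{-(n-1)} y)` of length `n`. The null cell `E_∞` is not refined further,
its label is the empty word. -/
def adapted {X κ : Type*} [MeasurableSpace X] (T : X ≃ᵐ X) (E : Set X) (Q : X → κ) :
    E → Block κ :=
  fun y => (List.range (entryTime T E y).toNat).map fun j => hatPartition E Q (T.symm^[j] y)

open Classical in
/-- The partition of `X` that consists of the cells of the adapted partition of `E` and of the cell
`X ∖ E`. -/
def adaptedExt {X κ : Type*} [MeasurableSpace X] (T : X ≃ᵐ X) (E : Set X) (Q : X → κ) :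
    X → ExtBlock κ :=
  fun x => if h : x ∈ E then some (adapted T E Q ⟨x, h⟩) else none

/-! ### Processes and finitary isomorphism -/

/-- The process `(T, P)`, i.e. the random variables `X_i = P ∘ Tⁱ` for `i ∈ ℤ`, as a map that sends
a point to its full `P`-name. -/
def process {X Λ : Type*} [MeasurableSpace X] (T : X ≃ᵐ X) (P : X → Λ) : X → (ℤ → Λ) :=
  fun x i => P (((T.toEquiv : Equiv.Perm X) ^ i) x)

/-- The law of the process `(T, P)` on the sequence space. -/
def processLaw {X Λ : Type*} [MeasurableSpace X] [MeasurableSpace Λ] (μ : Measure X) (T : X ≃ᵐ X)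
    (P : X → Λ) : Measure (ℤ → Λ) :=
  μ.map (process T P)

/-- The left shift on two-sided sequences. -/
def shift {Λ : Type*} (x : ℤ → Λ) : ℤ → Λ := fun i => x (i + 1)

/-- `φ` is a finitary code from `ν` to `ν'`: it is a measurable map that carries `ν` to `ν'`,
commutes a.e. with the shift, and for a.e. `x` there is `n` such that the finite block
`x_{-n} ⋯ x_n` determines (up to null sets) the zeroth coordinate of the image. -/
structure IsFinitaryCode {A B : Type*} [MeasurableSpace A] [MeasurableSpace B]
    (ν : Measure (ℤ → A)) (ν' : Measure (ℤ → B)) (φ : (ℤ → A) → (ℤ → B)) : Prop where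
  measurePreserving : MeasurePreserving φ ν ν'
  equivariant : ∀ᵐ x ∂ν, φ (shift x) = shift (φ x)
  finitary : ∀ᵐ x ∂ν, ∃ n : ℕ, ∀ᵐ y ∂ν, (∀ i : ℤ, |i| ≤ n → y i = x i) → φ y 0 = φ x 0

/-- Two stationary processes, given by their laws, are finitarily isomorphic: there is an
isomorphism mod null sets between them which is finitary and has a finitary inverse. -/
def FinitarilyIsomorphic {A B : Type*} [MeasurableSpace A] [MeasurableSpace B]
    (ν : Measure (ℤ → A)) (ν' : Measure (ℤ → B)) : Prop :=
  ∃ (φ : (ℤ → A) → (ℤ → B)) (ψ : (ℤ → B) → (ℤ → A)),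
    IsFinitaryCode ν ν' φ ∧ IsFinitaryCode ν' ν ψ ∧
      (∀ᵐ x ∂ν, ψ (φ x) = x) ∧ (∀ᵐ y ∂ν', φ (ψ y) = y)

end AdaptedPartition

end

noncomputable section

namespace AdaptedPartition

/-! Read the `Q̂`-name of a point backwards in time. The stars cut it into return words, and the
adapted label of `y ∈ E` is the word that starts at `y` and stops just before the previous visit to
`E`. A word is found by reading letters back to the previous star. Conversely, if the next visit to
`E` happens `k ≥ 0` steps after `x`, then the letter of `x` is entry `k` of the word found there.
Almost surely both searches end, by Poincaré recurrence and by sweeping out, so each code inspects a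
finite window. This is the finitary isomorphism (`encode_process`, `decode_process`).

The entropy formula comes from two coding arguments. By Gibbs' inequality (`staticEntropy_prod_le`,
`condEntropy_le`) every subprobability predictor costs at least the conditional entropy, and Kac's
formula in the form `lintegral_tower` turns a cost on `X` into a cost on `E`, summed over the column
below each point, with the factor `μ E`.

For one inequality, words are predicted letter by letter from the conditional law of a letter given
its `N` predecessors (`measure_mul_condEntropy_le`). The products are subprobabilities on return
words because such a word ends at its star (`tsum_wordProb_le`). A uniform predictor already shows
that the static entropy is finite.

For the other, a letter is predicted from the `M` preceding words and the part of the current word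
already read. These costs telescope along a word to at most its conditional information
(`sum_info_div_le`). The `M` words must be visible among the last `L` letters; otherwise a uniform
guess is made, at a cost that vanishes as `L → ∞` (`condEntropy_hatPartition_le`).

Both dynamical entropies are limits of conditional entropies (`exists_tendsto_entropyRate`). Since a
map and its inverse have the same joint entropies, the argument runs with `T⁻¹`, the direction in
which words are read. -/

/-! ### Information content -/

/-- The information content `-log q` of an event of probability `q`, with value `∞` at `0`. -/
def info (q : ℝ) : ℝ≥0∞ := if q = 0 then ∞ else ENNReal.ofReal (-Real.log q)

@[simp] theorem info_zero : info 0 = ∞ := by simp [info]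

@[simp] theorem info_one : info 1 = 0 := by simp [info]

theorem info_of_ne {q : ℝ} (hq : q ≠ 0) : info q = ENNReal.ofReal (-Real.log q) := by
  simp [info, hq]

theorem info_mul {a b : ℝ} (ha : 0 ≤ a) (ha1 : a ≤ 1) (hb : 0 ≤ b) (hb1 : b ≤ 1) :
    info (a * b) = info a + info b := by
  rcases eq_or_ne a 0 with rfl | ha0
  · simp
  rcases eq_or_ne b 0 with rfl | hb0
  · simp
  rw [info_of_ne ha0, info_of_ne hb0, info_of_ne (mul_ne_zero ha0 hb0), Real.log_mul ha0 hb0,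
    neg_add, ENNReal.ofReal_add]
  · simpa using Real.log_nonpos ha ha1
  · simpa using Real.log_nonpos hb hb1

theorem info_anti {a b : ℝ} (ha : 0 ≤ a) (hab : a ≤ b) : info b ≤ info a := by
  rcases eq_or_lt_of_le ha with rfl | ha0
  · simp
  · rw [info_of_ne ha0.ne', info_of_ne (ha0.trans_le hab).ne']
    exact ENNReal.ofReal_le_ofReal (neg_le_neg (Real.log_le_log ha0 hab))

/-! ### Partitions with measurable cells -/

/-- All cells of the partition are measurable. -/
def MeasCells {X Λ : Type*} [MeasurableSpace X] (P : X → Λ) : Prop :=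
  ∀ a, MeasurableSet (P ⁻¹' {a})

section Entropy

variable {X Λ Γ : Type*} [MeasurableSpace X] {μ : Measure X}

theorem MeasCells.preimage [Countable Λ] {P : X → Λ} (hP : MeasCells P) (s : Set Λ) :
    MeasurableSet (P ⁻¹' s) := by
  rw [← Set.biUnion_preimage_singleton]
  exact MeasurableSet.biUnion (Set.to_countable s) fun a _ => hP a

theorem MeasCells.comp [Countable Λ] {P : X → Λ} (hP : MeasCells P) (g : Λ → Γ) :
    MeasCells fun x => g (P x) :=
  fun a => hP.preimage (g ⁻¹' {a})

theorem MeasCells.comp_measurable {Y : Type*} [MeasurableSpace Y] {P : X → Λ} (hP : MeasCells P)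
    {S : Y → X} (hS : Measurable S) : MeasCells fun y => P (S y) :=
  fun a => hS (hP a)

theorem MeasCells.prodMk {P : X → Λ} {R : X → Γ} (hP : MeasCells P) (hR : MeasCells R) :
    MeasCells fun x => (P x, R x) := by
  rintro ⟨a, b⟩
  convert (hP a).inter (hR b) using 1
  ext x
  simp

theorem MeasCells.pi {ι : Type*} [Countable ι] {P : X → ι → Λ}
    (hP : ∀ i, MeasCells fun x => P x i) : MeasCells P := by
  intro a
  convert MeasurableSet.iInter fun i => hP i (a i) using 1
  ext x
  simp [funext_iff]

theorem MeasCells.join {P : X → Λ} (hP : MeasCells P) {S : X → X} (hS : Measurable S) (n : ℕ) :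
    MeasCells (join S P n) :=
  MeasCells.pi fun i => hP.comp_measurable (hS.iterate i)

theorem MeasCells.measurable_comp [Countable Λ] {P : X → Λ} (hP : MeasCells P) {Y : Type*}
    [MeasurableSpace Y] (g : Λ → Y) : Measurable fun x => g (P x) :=
  fun s _ => hP.preimage (g ⁻¹' s)

theorem lintegral_comp_label [Countable Λ] {P : X → Λ} (hP : MeasCells P) (F : Λ → ℝ≥0∞) :
    ∫⁻ x, F (P x) ∂μ = ∑' a, μ (P ⁻¹' {a}) * F a := by
  -- The discrete σ-algebra makes an arbitrary `F` measurable.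
  let _ : MeasurableSpace Λ := ⊤
  have hm : Measurable P := measurable_to_countable' hP
  rw [← lintegral_map (f := F) (fun _ _ => trivial) hm, lintegral_countable']
  refine tsum_congr fun a => ?_
  rw [Measure.map_apply hm trivial, mul_comm]

theorem staticEntropy_congr {P R : X → Λ} (h : P =ᵐ[μ] R) :
    staticEntropy μ P = staticEntropy μ R := by
  refine tsum_congr fun a => ?_
  have : μ.real (P ⁻¹' {a}) = μ.real (R ⁻¹' {a}) := by
    refine measureReal_congr ?_
    filter_upwards [h] with x hx
    exact congrArg (fun z => z = a) hx
  rw [this]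

theorem staticEntropy_comp_measurePreserving {P : X → Λ} (hP : MeasCells P) {S : X → X}
    (hS : MeasurePreserving S μ μ) : staticEntropy μ (fun x => P (S x)) = staticEntropy μ P := by
  refine tsum_congr fun a => ?_
  have : μ.real ((fun x => P (S x)) ⁻¹' {a}) = μ.real (P ⁻¹' {a}) :=
    hS.measureReal_preimage (hP a).nullMeasurableSet
  rw [this]

/-- Labels outside the range of `g` name empty cells, which contribute `negMulLog 0 = 0`. -/
theorem staticEntropy_comp_injective {g : Λ → Γ} (hg : g.Injective) (P : X → Λ) :
    staticEntropy μ (fun x => g (P x)) = staticEntropy μ P := by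
  unfold staticEntropy
  rw [← hg.tsum_eq]
  · refine tsum_congr fun a => ?_
    congr 3
    ext x
    simp [hg.eq_iff]
  · intro b hb
    by_contra hb'
    refine hb ?_
    have : (fun x => g (P x)) ⁻¹' {b} = ∅ := by
      ext x
      simpa using fun h => hb' ⟨P x, h⟩
    simp [this]

variable [IsProbabilityMeasure μ]

theorem staticEntropy_eq_zero_of_subsingleton [Subsingleton Λ] (P : X → Λ) :
    staticEntropy μ P = 0 := by
  refine ENNReal.tsum_eq_zero.2 fun a => ?_
  have : P ⁻¹' {a} = Set.univ := by
    ext x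
    simpa using Subsingleton.elim _ _
  simp [this]

theorem tsum_measure_cell [Countable Λ] {P : X → Λ} (hP : MeasCells P) :
    ∑' a, μ (P ⁻¹' {a}) = 1 := by
  simpa using (lintegral_comp_label (μ := μ) hP (fun _ => 1)).symm

/-- At `p = 0` the two sides agree because `0 * ∞ = 0`; this is what makes the value `info 0 = ∞`
harmless on null cells. -/
theorem ofReal_negMulLog_eq (p : ℝ) (hp : 0 ≤ p) (hp1 : p ≤ 1) :
    ENNReal.ofReal (Real.negMulLog p) = ENNReal.ofReal p * info p := by
  rcases eq_or_lt_of_le hp with rfl | h0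
  · simp
  · rw [info_of_ne h0.ne', ← ENNReal.ofReal_mul hp]
    congr 1
    simp [Real.negMulLog]

theorem staticEntropy_eq_lintegral [Countable Λ] {P : X → Λ} (hP : MeasCells P) :
    staticEntropy μ P = ∫⁻ x, info (μ.real (P ⁻¹' {P x})) ∂μ := by
  rw [lintegral_comp_label hP (fun a => info (μ.real (P ⁻¹' {a})))]
  refine tsum_congr fun a => ?_
  rw [ofReal_negMulLog_eq _ measureReal_nonneg measureReal_le_one, ofReal_measureReal]

/-- The pointwise inequality behind Gibbs' inequality. -/
theorem mul_info_add_le {p s q : ℝ} (hp : 0 ≤ p) (hp1 : p ≤ 1) (hps : p ≤ s) (hs1 : s ≤ 1)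
    (hq : 0 ≤ q) (hq1 : q ≤ 1) :
    ENNReal.ofReal p * info p + ENNReal.ofReal p ≤
      ENNReal.ofReal p * info s + ENNReal.ofReal p * info q + ENNReal.ofReal s * ENNReal.ofReal q := by
  rcases eq_or_lt_of_le hp with rfl | h0
  · simp
  have hs0 := h0.trans_le hps
  rcases eq_or_lt_of_le hq with rfl | hq0
  · simp [ENNReal.mul_top, h0]
  have l1 := Real.log_nonpos hp hp1
  have l2 := Real.log_nonpos hs0.le hs1
  have l3 := Real.log_nonpos hq hq1
  rw [info_of_ne h0.ne', info_of_ne hs0.ne', info_of_ne hq0.ne', ← ENNReal.ofReal_mul hp,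
    ← ENNReal.ofReal_mul hp, ← ENNReal.ofReal_mul hp, ← ENNReal.ofReal_mul hs0.le,
    ← ENNReal.ofReal_add (by nlinarith) hp, ← ENNReal.ofReal_add (by nlinarith) (by nlinarith),
    ← ENNReal.ofReal_add (by nlinarith) (by positivity)]
  refine ENNReal.ofReal_le_ofReal ?_
  -- The inequality `log t ≤ t - 1` at `t = s * q / p`, to be multiplied by `p`.
  have key := Real.log_le_sub_one_of_pos (div_pos (mul_pos hs0 hq0) h0)
  rw [Real.log_div (by positivity) (by positivity), Real.log_mul hs0.ne' hq0.ne'] at key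
  have := mul_le_mul_of_nonneg_left key hp
  have e : p * (s * q / p - 1) = s * q - p := by field_simp
  rw [e] at this
  nlinarith

/-- Gibbs' inequality: the joint entropy of `Y` and `Z` is at most the entropy of `Z` plus the mean
information content of `Y` predicted from `Z` by a subprobability kernel `q`. -/
theorem staticEntropy_prod_le [Countable Λ] [Countable Γ] {Y : X → Λ} {Z : X → Γ}
    (hY : MeasCells Y) (hZ : MeasCells Z) {q : Γ → Λ → ℝ} (hq : ∀ z y, 0 ≤ q z y)
    (hsum : ∀ z, ∑' y, ENNReal.ofReal (q z y) ≤ 1) :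
    staticEntropy μ (fun x => (Z x, Y x)) ≤ staticEntropy μ Z + ∫⁻ x, info (q (Z x) (Y x)) ∂μ := by
  set W : X → Γ × Λ := fun x => (Z x, Y x) with hWdef
  have hW : MeasCells W := hZ.prodMk hY
  have hq1 : ∀ z y, q z y ≤ 1 := fun z y =>
    ENNReal.ofReal_le_one.1 ((ENNReal.le_tsum y).trans (hsum z))
  have hsub : ∀ a : Γ × Λ, W ⁻¹' {a} ⊆ Z ⁻¹' {a.1} := by
    rintro a x rfl
    rfl
  -- The `1` is the total mass of the cells of `W`. On the right the predicted mass is at most `1`,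
  -- so a finite term cancels and no entropy has to be finite.
  have h1 : staticEntropy μ W + 1 ≤
      ∑' a : Γ × Λ, (μ (W ⁻¹' {a}) * info (μ.real (Z ⁻¹' {a.1})) + μ (W ⁻¹' {a}) * info (q a.1 a.2)
        + μ (Z ⁻¹' {a.1}) * ENNReal.ofReal (q a.1 a.2)) := by
    rw [← tsum_measure_cell (μ := μ) hW, staticEntropy, ← ENNReal.tsum_add]
    refine ENNReal.tsum_le_tsum fun a => ?_
    rw [ofReal_negMulLog_eq _ measureReal_nonneg measureReal_le_one]
    have := mul_info_add_le (p := μ.real (W ⁻¹' {a})) (s := μ.real (Z ⁻¹' {a.1})) (q := q a.1 a.2)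
      measureReal_nonneg measureReal_le_one (measureReal_mono (hsub a)) measureReal_le_one
      (hq _ _) (hq1 _ _)
    have e1 : ENNReal.ofReal (μ.real (W ⁻¹' {a})) = μ (W ⁻¹' {a}) := ofReal_measureReal
    have e2 : ENNReal.ofReal (μ.real (Z ⁻¹' {a.1})) = μ (Z ⁻¹' {a.1}) := ofReal_measureReal
    rw [e1, e2] at this
    rwa [e1]
  have h2 : ∑' a : Γ × Λ, μ (Z ⁻¹' {a.1}) * ENNReal.ofReal (q a.1 a.2) ≤ 1 := by
    rw [ENNReal.tsum_prod (f := fun z y => μ (Z ⁻¹' {z}) * ENNReal.ofReal (q z y)),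
      ← tsum_measure_cell (μ := μ) hZ]
    refine ENNReal.tsum_le_tsum fun z => ?_
    rw [ENNReal.tsum_mul_left]
    exact mul_le_of_le_one_right' (hsum z)
  rw [ENNReal.tsum_add, ENNReal.tsum_add,
    ← lintegral_comp_label hW (fun a => info (μ.real (Z ⁻¹' {a.1}))),
    ← lintegral_comp_label hW (fun a => info (q a.1 a.2)),
    ← staticEntropy_eq_lintegral hZ] at h1
  have h3 := h1.trans (add_le_add_right h2 _)
  exact (ENNReal.add_le_add_iff_right ENNReal.one_ne_top).1 h3

/-- The conditional probability of the label `y` of `Y` given the label `z` of `Z`. -/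
def condProb (μ : Measure X) (Y : X → Λ) (Z : X → Γ) (z : Γ) (y : Λ) : ℝ :=
  μ.real ((fun x => (Z x, Y x)) ⁻¹' {(z, y)}) / μ.real (Z ⁻¹' {z})

omit [IsProbabilityMeasure μ] in
theorem condProb_nonneg (Y : X → Λ) (Z : X → Γ) (z : Γ) (y : Λ) : 0 ≤ condProb μ Y Z z y :=
  div_nonneg measureReal_nonneg measureReal_nonneg

/-- For null `B` every quotient is `0`, so conditional laws remain subprobabilities on null cells
too. -/
theorem tsum_div_measureReal_le_one [Countable Λ] {B : Set X} {A : Λ → Set X}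
    (hA : ∀ y, MeasurableSet (A y)) (hAB : ∀ y, A y ⊆ B)
    (hd : Pairwise (Function.onFun Disjoint A)) :
    ∑' y, ENNReal.ofReal (μ.real (A y) / μ.real B) ≤ 1 := by
  have h : ∀ y, ENNReal.ofReal (μ.real (A y) / μ.real B) ≤ μ (A y) * (μ B)⁻¹ := by
    intro y
    rcases eq_or_ne (μ.real B) 0 with h0 | h0
    · simp [h0]
    · rw [ENNReal.ofReal_div_of_pos (lt_of_le_of_ne measureReal_nonneg h0.symm),
        ofReal_measureReal, ofReal_measureReal, div_eq_mul_inv]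
  refine (ENNReal.tsum_le_tsum h).trans ?_
  rw [ENNReal.tsum_mul_right, ← measure_iUnion hd hA]
  exact (mul_le_mul_left (measure_mono (Set.iUnion_subset hAB)) _).trans
    (ENNReal.mul_inv_le_one _)

theorem tsum_condProb_le [Countable Λ] {Y : X → Λ} {Z : X → Γ}
    (hY : MeasCells Y) (hZ : MeasCells Z) (z : Γ) :
    ∑' y, ENNReal.ofReal (condProb μ Y Z z y) ≤ 1 := by
  refine tsum_div_measureReal_le_one (fun y => (hZ.prodMk hY) _) ?_ ?_
  · rintro y x hx
    simp only [Set.mem_preimage, Set.mem_singleton_iff, Prod.mk.injEq] at hx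
    exact hx.1
  · intro a b hab
    refine Set.disjoint_left.2 fun x hx hx' => hab ?_
    simp only [Set.mem_preimage, Set.mem_singleton_iff, Prod.mk.injEq] at hx hx'
    exact hx.2.symm.trans hx'.2

theorem condProb_le_one [Countable Λ] {Y : X → Λ} {Z : X → Γ}
    (hY : MeasCells Y) (hZ : MeasCells Z) (z : Γ) (y : Λ) : condProb μ Y Z z y ≤ 1 :=
  ENNReal.ofReal_le_one.1 ((ENNReal.le_tsum y).trans (tsum_condProb_le hY hZ z))

/-- The chain rule for the static entropy. -/
theorem staticEntropy_prod_eq [Countable Λ] [Countable Γ] {Y : X → Λ} {Z : X → Γ}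
    (hY : MeasCells Y) (hZ : MeasCells Z) :
    staticEntropy μ (fun x => (Z x, Y x)) =
      staticEntropy μ Z + ∫⁻ x, info (condProb μ Y Z (Z x) (Y x)) ∂μ := by
  have hW := hZ.prodMk hY
  rw [staticEntropy_eq_lintegral hW, staticEntropy_eq_lintegral hZ,
    ← lintegral_add_left (hZ.measurable_comp (fun z => info (μ.real (Z ⁻¹' {z}))))]
  refine lintegral_congr fun x => ?_
  rw [← info_mul measureReal_nonneg measureReal_le_one (condProb_nonneg _ _ _ _)
    (condProb_le_one hY hZ _ _), condProb]
  rcases eq_or_ne (μ.real (Z ⁻¹' {Z x})) 0 with h0 | h0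
  · have : μ.real ((fun x => (Z x, Y x)) ⁻¹' {(Z x, Y x)}) = 0 := by
      refine le_antisymm (le_trans (measureReal_mono ?_) h0.le) measureReal_nonneg
      intro x' hx'
      simp only [Set.mem_preimage, Set.mem_singleton_iff, Prod.mk.injEq] at hx'
      exact hx'.1
    simp [h0, this]
  · rw [mul_div_cancel₀ _ h0]

/-- Gibbs' inequality with a trivial `Z`. -/
theorem staticEntropy_le_lintegral_info [Countable Λ] {Y : X → Λ} (hY : MeasCells Y)
    {q : Λ → ℝ} (hq : ∀ y, 0 ≤ q y) (hsum : ∑' y, ENNReal.ofReal (q y) ≤ 1) :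
    staticEntropy μ Y ≤ ∫⁻ x, info (q (Y x)) ∂μ := by
  have hZ : MeasCells fun _ : X => () := fun _ => MeasurableSet.const _
  have := staticEntropy_prod_le (μ := μ) hY hZ (q := fun _ => q) (fun _ => hq) fun _ => hsum
  rwa [staticEntropy_eq_zero_of_subsingleton (Λ := Unit), zero_add,
    staticEntropy_comp_injective (g := fun y : Λ => ((), y)) (Prod.mk_right_injective ())] at this

/-- The conditional entropy of `Y` given `Z`. -/
def condEntropy (μ : Measure X) (Y : X → Λ) (Z : X → Γ) : ℝ≥0∞ :=
  ∫⁻ x, info (condProb μ Y Z (Z x) (Y x)) ∂μ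

theorem condEntropy_le [Countable Λ] [Countable Γ] {Y : X → Λ} {Z : X → Γ}
    (hY : MeasCells Y) (hZ : MeasCells Z) (hfin : staticEntropy μ Z ≠ ∞) {q : Γ → Λ → ℝ}
    (hq : ∀ z y, 0 ≤ q z y) (hsum : ∀ z, ∑' y, ENNReal.ofReal (q z y) ≤ 1) :
    condEntropy μ Y Z ≤ ∫⁻ x, info (q (Z x) (Y x)) ∂μ := by
  have := staticEntropy_prod_le (μ := μ) hY hZ hq hsum
  rw [staticEntropy_prod_eq hY hZ] at this
  exact (ENNReal.add_le_add_iff_left hfin).1 this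

/-- Conditioning on more information lowers the entropy. -/
theorem condEntropy_anti {Γ' : Type*} [Countable Λ] [Countable Γ] [Countable Γ'] {Y : X → Λ}
    {Z : X → Γ} (hY : MeasCells Y) (hZ : MeasCells Z) (hfin : staticEntropy μ Z ≠ ∞) (g : Γ → Γ') :
    condEntropy μ Y Z ≤ condEntropy μ Y (fun x => g (Z x)) :=
  condEntropy_le hY hZ hfin (q := fun z y => condProb μ Y (fun x => g (Z x)) (g z) y)
    (fun _ _ => condProb_nonneg _ _ _ _) fun z => tsum_condProb_le hY (hZ.comp g) (g z)

omit [IsProbabilityMeasure μ] in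
/-- `Z` and `g ∘ Z` carry the same information if `g` is injective. -/
theorem condEntropy_comp_injective {Γ' : Type*} {g : Γ → Γ'} (hg : g.Injective) (Y : X → Λ)
    (Z : X → Γ) : condEntropy μ Y (fun x => g (Z x)) = condEntropy μ Y Z := by
  refine lintegral_congr fun x => ?_
  have h1 : (fun x => (g (Z x), Y x)) ⁻¹' {(g (Z x), Y x)} =
      (fun x => (Z x, Y x)) ⁻¹' {(Z x, Y x)} := by
    ext x'
    simp [hg.eq_iff]
  have h2 : (fun x => g (Z x)) ⁻¹' {g (Z x)} = Z ⁻¹' {Z x} := by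
    ext x'
    simp [hg.eq_iff]
  rw [condProb, condProb, h1, h2]

/-! ### Dynamical entropy as a limit of conditional entropies -/

/-- Split off label `0`: the other `n` labels form the join read at `S x`, whose entropy is that of
the join at `x` since `S` preserves `μ`. What remains is the chain rule. -/
theorem staticEntropy_join_succ [Countable Λ] {P : X → Λ} (hP : MeasCells P) {S : X → X}
    (hS : MeasurePreserving S μ μ) (n : ℕ) :
    staticEntropy μ (join S P (n + 1)) =
      staticEntropy μ (join S P n) + condEntropy μ P (fun x => join S P n (S x)) := by
  have hJ := (hP.join hS.measurable n)
  rw [← staticEntropy_comp_measurePreserving hJ hS, condEntropy, ← staticEntropy_prod_eq hP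
    (hJ.comp_measurable hS.measurable)]
  have hg : (fun a : Fin (n + 1) → Λ => ((fun i : Fin n => a i.succ), a 0)).Injective := by
    intro a b hab
    simp only [Prod.mk.injEq, funext_iff] at hab
    ext i
    refine Fin.cases hab.2 hab.1 i
  rw [← staticEntropy_comp_injective hg]
  rfl

theorem staticEntropy_join_ne_top [Countable Λ] {P : X → Λ} (hP : MeasCells P) {S : X → X}
    (hS : MeasurePreserving S μ μ) (hfin : staticEntropy μ P ≠ ∞) (n : ℕ) :
    staticEntropy μ (join S P n) ≠ ∞ := by
  induction n with
  | zero => simp [staticEntropy_eq_zero_of_subsingleton]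
  | succ n ih =>
    rw [staticEntropy_join_succ hP hS]
    refine ENNReal.add_ne_top.2 ⟨ih, ne_top_of_le_ne_top hfin ?_⟩
    have h := condEntropy_anti (Γ' := Unit) (μ := μ) hP
      ((hP.join hS.measurable n).comp_measurable hS.measurable)
      (by rwa [staticEntropy_comp_measurePreserving (hP.join hS.measurable n) hS]) (fun _ => ())
    refine h.trans (le_of_eq ?_)
    rw [staticEntropy_eq_lintegral hP, condEntropy]
    refine lintegral_congr fun x => ?_
    have h1 : (fun _ : X => ()) ⁻¹' {()} = Set.univ := by ext; simp
    have h2 : (fun x : X => ((), P x)) ⁻¹' {((), P x)} = P ⁻¹' {P x} := by ext; simp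
    rw [condProb, h1, h2]
    simp

/-- The dynamical entropy of a partition with finite static entropy is the limit of the conditional
entropies of `P` given the next `n` labels. -/
theorem exists_tendsto_entropyRate [Countable Λ] {P : X → Λ} (hP : MeasCells P) {S : X → X}
    (hS : MeasurePreserving S μ μ) (hfin : staticEntropy μ P ≠ ∞) :
    ∃ h : ℝ≥0∞, h ≠ ∞ ∧ Tendsto (entropyRate μ S P) atTop (𝓝 h) ∧
      Tendsto (fun n => condEntropy μ P (fun x => join S P n (S x))) atTop (𝓝 h) := by
  set c : ℕ → ℝ≥0∞ := fun n => condEntropy μ P (fun x => join S P n (S x)) with hc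
  have hJfin := staticEntropy_join_ne_top hP hS hfin
  have hcfin : ∀ n, c n ≠ ∞ := fun n =>
    ne_top_of_le_ne_top (hJfin (n + 1))
      (by rw [staticEntropy_join_succ hP hS]; exact le_add_self)
  -- Dropping the last of `n + 1` labels leaves the window of length `n`, so longer windows
  -- condition on more.
  have hanti : Antitone c := by
    refine antitone_nat_of_succ_le fun n => ?_
    refine condEntropy_anti hP ((hP.join hS.measurable (n + 1)).comp_measurable hS.measurable)
      (by rw [staticEntropy_comp_measurePreserving (hP.join hS.measurable (n + 1)) hS]
          exact hJfin _) (fun a : Fin (n + 1) → Λ => fun i : Fin n => a i.castSucc)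
  have hlim := tendsto_atTop_iInf hanti
  have hh : (⨅ n, c n) ≠ ∞ := ne_top_of_le_ne_top (hcfin 0) (iInf_le _ _)
  refine ⟨⨅ n, c n, hh, ?_, hlim⟩
  have hsum : ∀ n, staticEntropy μ (join S P n) = ∑ i ∈ Finset.range n, c i := by
    intro n
    induction n with
    | zero => simp [staticEntropy_eq_zero_of_subsingleton]
    | succ n ih => rw [staticEntropy_join_succ hP hS, Finset.sum_range_succ, ih]
  -- The entropy of the `n`-fold join is a partial sum of `c`, hence the rate is a Cesàro mean of a
  -- convergent sequence.
  have hces := ((ENNReal.tendsto_toReal hh).comp hlim).cesaro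
  have := (ENNReal.continuous_ofReal.tendsto _).comp hces
  rw [ENNReal.ofReal_toReal hh] at this
  refine this.congr' ?_
  filter_upwards [eventually_gt_atTop 0] with n hn
  have hn' : (0 : ℝ) < n := by exact_mod_cast hn
  simp only [Function.comp_apply, entropyRate, hsum]
  rw [← ENNReal.toReal_sum fun i _ => hcfin i, inv_mul_eq_div, ENNReal.ofReal_div_of_pos hn',
    ENNReal.ofReal_toReal (ENNReal.sum_ne_top.2 fun i _ => hcfin i), ENNReal.ofReal_natCast]

omit [IsProbabilityMeasure μ] in
/-- A map and its inverse have the same joint entropies. -/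
theorem staticEntropy_join_inverse [Countable Λ] {P : X → Λ} (hP : MeasCells P) {S T : X → X}
    (hS : Measurable S) (hT : MeasurePreserving T μ μ) (hST : ∀ᵐ x ∂μ, S (T x) = x) (n : ℕ) :
    staticEntropy μ (join T P n) = staticEntropy μ (join S P n) := by
  have hae : ∀ᵐ x ∂μ, ∀ m : ℕ, S (T (T^[m] x)) = T^[m] x :=
    ae_all_iff.2 fun m => (hT.iterate m).quasiMeasurePreserving.ae hST
  have key : ∀ᵐ x ∂μ, ∀ j m : ℕ, S^[j] (T^[j + m] x) = T^[m] x := by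
    filter_upwards [hae] with x hx j
    induction j with
    | zero => simp
    | succ j ih =>
      intro m
      rw [Function.iterate_succ_apply, show j + 1 + m = (j + m) + 1 by ring,
        Function.iterate_succ_apply', hx, ih]
  -- The `S`-word at `T^(n-1) x` is the `T`-word at `x` reversed: move the base point by invariance,
  -- then relabel by the reversal of indices.
  rw [← staticEntropy_comp_measurePreserving (hP.join hS n) (hT.iterate (n - 1))]
  have hg : (fun a : Fin n → Λ => fun i : Fin n => a i.rev).Injective := by
    intro a b hab
    ext i
    simpa using congrFun hab i.rev
  rw [← staticEntropy_comp_injective hg (join T P n)]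
  refine staticEntropy_congr ?_
  filter_upwards [key] with x hx
  ext i
  simp only [join]
  have := hx i (n - 1 - i)
  rw [show (i : ℕ) + (n - 1 - i) = n - 1 by omega] at this
  rw [this, Fin.val_rev, show n - (i + 1 : ℕ) = n - 1 - i by omega]

end Entropy

/-! ### Return times -/

section ReturnTime

variable {X : Type*} {T : X → X} {E : Set X} {x : X}

theorem lt_returnTime_iff {n : ℕ} :
    (n : ℕ∞) < returnTime T E x ↔ ∀ i, 1 ≤ i → i ≤ n → T^[i] x ∉ E := by
  classical
  unfold returnTime
  split_ifs with h
  · rw [Nat.cast_lt, Nat.lt_find_iff]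
    exact ⟨fun H i h1 h2 h3 => H i h2 ⟨h1, h3⟩, fun H i h2 h3 => H i h3.1 h2 h3.2⟩
  · push Not at h
    simpa using fun i h1 _ => h i h1

theorem returnTime_ne_top_iff : returnTime T E x ≠ ⊤ ↔ ∃ n, 1 ≤ n ∧ T^[n] x ∈ E := by
  classical
  unfold returnTime
  split_ifs with h <;> simpa using h

/-- A return takes at least one step, so the value `0` of `toNat` is free to encode "never". -/
theorem returnTime_toNat_eq_zero_iff : (returnTime T E x).toNat = 0 ↔ returnTime T E x = ⊤ := by
  rw [ENat.toNat_eq_zero, or_iff_right]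
  intro h
  have := (returnTime_eq_coe_iff (n := 0)).1 (by simpa using h)
  omega

theorem toNat_returnTime_eq_iff {n : ℕ} (hn : 1 ≤ n) :
    (returnTime T E x).toNat = n ↔ returnTime T E x = n := by
  rw [ENat.toNat_eq_iff (by omega)]

/-- A finite return time `n` depends only on the visits at times `1, …, n`. Two systems are allowed,
since finite windows of sequences and names of points are both compared this way. -/
theorem returnTime_congr {X Y : Type*} {T : X → X} {S : Y → Y} {E : Set X} {F : Set Y} {x : X}
    {y : Y} {n : ℕ} (h : returnTime T E x = n)
    (hxy : ∀ j, 1 ≤ j → j ≤ n → (T^[j] x ∈ E ↔ S^[j] y ∈ F)) : returnTime S F y = n := by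
  obtain ⟨⟨h1, h2⟩, h3⟩ := returnTime_eq_coe_iff.1 h
  refine returnTime_eq_coe_iff.2 ⟨⟨h1, (hxy n h1 le_rfl).1 h2⟩, fun m hm hm' => ?_⟩
  exact h3 m hm ⟨hm'.1, (hxy m hm'.1 hm.le).2 hm'.2⟩

variable [MeasurableSpace X]

theorem measurableSet_iterate_mem (hT : Measurable T) (hE : MeasurableSet E) (n : ℕ) :
    MeasurableSet {x | T^[n] x ∈ E} :=
  hT.iterate n hE

theorem measCells_returnTime (hT : Measurable T) (hE : MeasurableSet E) :
    MeasCells (returnTime T E) := by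
  have hn : ∀ n : ℕ, MeasurableSet (returnTime T E ⁻¹' {(n : ℕ∞)}) := by
    intro n
    have : returnTime T E ⁻¹' {(n : ℕ∞)} = {x | (1 ≤ n ∧ T^[n] x ∈ E) ∧
        ∀ m < n, ¬ (1 ≤ m ∧ T^[m] x ∈ E)} := by
      ext x
      exact returnTime_eq_coe_iff
    rw [this]
    have h1 : ∀ m : ℕ, MeasurableSet {x | 1 ≤ m ∧ T^[m] x ∈ E} := fun m =>
      (MeasurableSet.const _).inter (measurableSet_iterate_mem hT hE m)
    refine (h1 n).inter ?_
    have e : {x | ∀ m < n, ¬ (1 ≤ m ∧ T^[m] x ∈ E)} =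
        ⋂ m, ⋂ _ : m < n, {x | 1 ≤ m ∧ T^[m] x ∈ E}ᶜ := by
      ext x
      simp
    change MeasurableSet {x | ∀ m < n, ¬ (1 ≤ m ∧ T^[m] x ∈ E)}
    rw [e]
    exact MeasurableSet.iInter fun m => MeasurableSet.iInter fun _ => (h1 m).compl
  intro a
  induction a using ENat.recTopCoe with
  | coe n => exact hn n
  | top =>
    have : returnTime T E ⁻¹' {⊤} = (⋃ n : ℕ, returnTime T E ⁻¹' {(n : ℕ∞)})ᶜ := by
      ext x
      cases h : returnTime T E x <;> simp [h]
    rw [this]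
    exact (MeasurableSet.iUnion hn).compl

/-- Poincaré recurrence. -/
theorem ae_mem_imp_frequently_iterate_mem {μ : Measure X} [IsFiniteMeasure μ]
    (hT : MeasurePreserving T μ μ) (hE : MeasurableSet E) :
    ∀ᵐ x ∂μ, x ∈ E → ∃ᶠ n in atTop, T^[n] x ∈ E :=
  hT.conservative.ae_mem_imp_frequently_image_mem hE.nullMeasurableSet

theorem ae_mem_imp_returnTime_ne_top {μ : Measure X} [IsFiniteMeasure μ]
    (hT : MeasurePreserving T μ μ) (hE : MeasurableSet E) :
    ∀ᵐ x ∂μ, x ∈ E → returnTime T E x ≠ ⊤ := by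
  filter_upwards [ae_mem_imp_frequently_iterate_mem hT hE] with x hx hxE
  obtain ⟨n, hn, h⟩ := frequently_atTop.1 (hx hxE) 1
  exact returnTime_ne_top_iff.2 ⟨n, hn, h⟩

end ReturnTime

section Inverse

variable {X : Type*} [MeasurableSpace X] (T : X ≃ᵐ X)

theorem symm_iterate_iterate {m n : ℕ} (h : m ≤ n) (x : X) :
    T.symm^[m] (T^[n] x) = T^[n - m] x := by
  have hl : Function.LeftInverse T.symm T := T.symm_apply_apply
  conv_lhs => rw [← Nat.add_sub_cancel' h, Function.iterate_add_apply]
  exact hl.iterate m _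

theorem iterate_symm_iterate {m n : ℕ} (h : m ≤ n) (x : X) :
    T^[m] (T.symm^[n] x) = T.symm^[n - m] x :=
  symm_iterate_iterate T.symm h x

end Inverse

/-! ### The induced system -/

section Induced

variable {X : Type*} [MeasurableSpace X] {μ : Measure X} {E : Set X}

theorem lintegral_inducedMeasure (hE : MeasurableSet E) (f : X → ℝ≥0∞) :
    ∫⁻ y : E, f y ∂(inducedMeasure μ E) = (μ E)⁻¹ * ∫⁻ x in E, f x ∂μ := by
  rw [inducedMeasure, lintegral_smul_measure, lintegral_subtype_comap hE, smul_eq_mul]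

theorem inducedMeasure_apply (hE : MeasurableSet E) (A : Set X) :
    inducedMeasure μ E (Subtype.val ⁻¹' A) = (μ E)⁻¹ * μ (E ∩ A) := by
  rw [inducedMeasure, Measure.smul_apply, comap_subtype_coe_apply hE, smul_eq_mul,
    Subtype.image_preimage_coe]

theorem ae_inducedMeasure (hE : MeasurableSet E) {p : X → Prop} (h : ∀ᵐ x ∂μ, x ∈ E → p x) :
    ∀ᵐ y : E ∂(inducedMeasure μ E), p y := by
  refine Measure.ae_smul_measure ?_ _
  rw [← ae_restrict_iff_subtype hE, ae_restrict_iff' hE]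
  exact h

theorem isProbabilityMeasure_inducedMeasure [IsFiniteMeasure μ] (hE : MeasurableSet E)
    (h0 : μ E ≠ 0) : IsProbabilityMeasure (inducedMeasure μ E) := by
  constructor
  have := inducedMeasure_apply (μ := μ) hE Set.univ
  rw [Set.preimage_univ, Set.inter_univ] at this
  rw [this, ENNReal.inv_mul_cancel h0 (measure_ne_top _ _)]

theorem measurable_inducedMap {T : X → X} (hT : Measurable T) (hE : MeasurableSet E) :
    Measurable (inducedMap T E) := by
  refine Measurable.subtype_mk ?_
  have h1 : Measurable fun p : ℕ × E => T^[p.1] p.2 :=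
    measurable_from_prod_countable_right fun n => (hT.iterate n).comp measurable_subtype_coe
  have h2 : Measurable fun y : E => (returnTime T E y).toNat :=
    ((measCells_returnTime hT hE).measurable_comp ENat.toNat).comp measurable_subtype_coe
  exact h1.comp (h2.prodMk measurable_id)

/-- Cut the preimage of `A` by the return time (`B₁`) and `A` itself by the entry time (`B₂`). As
`T` is invertible, `B₁ n` is exactly the preimage of `B₂ n` under `T^(n+1)`, so the pieces have
equal measure. Recurrence for `T` and for `T⁻¹` ensures that the pieces exhaust both sets. -/
theorem measurePreserving_inducedMap [IsFiniteMeasure μ] (T : X ≃ᵐ X)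
    (hT : MeasurePreserving T μ μ) (hE : MeasurableSet E) :
    MeasurePreserving (inducedMap T E) (inducedMeasure μ E) (inducedMeasure μ E) := by
  refine ⟨measurable_inducedMap T.measurable hE, Measure.ext fun B hB => ?_⟩
  rw [Measure.map_apply (measurable_inducedMap T.measurable hE) hB]
  obtain ⟨A, hA, rfl⟩ := hB
  have hTs : MeasurePreserving T.symm μ μ := hT.symm T
  have h1 : ∀ᵐ x ∂μ, x ∈ E → (returnTime T E x).toNat ≠ 0 := by
    filter_upwards [ae_mem_imp_returnTime_ne_top hT hE] with x hx hxE h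
    exact hx hxE (returnTime_toNat_eq_zero_iff.1 h)
  have h2 : ∀ᵐ x ∂μ, x ∈ E → (returnTime T.symm E x).toNat ≠ 0 := by
    filter_upwards [ae_mem_imp_returnTime_ne_top hTs hE] with x hx hxE h
    exact hx hxE (returnTime_toNat_eq_zero_iff.1 h)
  set B₁ : ℕ → Set X := fun n => {x | x ∈ E ∧ returnTime T E x = (n + 1 : ℕ) ∧ T^[n + 1] x ∈ A}
  set B₂ : ℕ → Set X := fun n => {x | x ∈ E ∧ returnTime T.symm E x = (n + 1 : ℕ) ∧ x ∈ A}
  have m1 : ∀ n, MeasurableSet (B₁ n) := fun n =>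
    hE.inter ((measCells_returnTime T.measurable hE _).inter (T.measurable.iterate _ hA))
  have m2 : ∀ n, MeasurableSet (B₂ n) := fun n =>
    hE.inter ((measCells_returnTime T.symm.measurable hE _).inter hA)
  have hB : ∀ n, B₁ n = T^[n + 1] ⁻¹' (B₂ n) := by
    intro n
    ext x
    simp only [B₁, B₂, Set.mem_ofPred_eq, Set.mem_preimage]
    have aux : ∀ hx : x ∈ E, ∀ hy : T^[n + 1] x ∈ E,
        returnTime T.symm E (T^[n + 1] x) = (n + 1 : ℕ) ↔ returnTime T E x = (n + 1 : ℕ) := by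
      intro hx hy
      refine (entryTime_eq_coe_iff T E ⟨_, hy⟩ (n + 1)).trans ⟨?_, ?_⟩
      · rintro ⟨z, hz, hr⟩
        have := congrArg Subtype.val hz
        simp only [inducedMap, hr, ENat.toNat_natCast] at this
        rw [← (T.injective.iterate _) this, hr]
      · intro hr
        exact ⟨⟨x, hx⟩, Subtype.ext (by simp only [inducedMap, hr, ENat.toNat_natCast]), hr⟩
    constructor
    · rintro ⟨hx, hr, hA⟩
      have hy := (returnTime_eq_coe_iff.1 hr).1.2
      exact ⟨hy, (aux hx hy).2 hr, hA⟩
    · rintro ⟨hy, hr, hA⟩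
      have hx := (returnTime_eq_coe_iff.1 hr).1.2
      rw [symm_iterate_iterate T le_rfl] at hx
      simp only [Nat.sub_self, Function.iterate_zero, id] at hx
      exact ⟨hx, (aux hx hy).1 hr, hA⟩
  have d1 : Pairwise (Function.onFun Disjoint B₁) := fun i j hij =>
    Set.disjoint_left.2 fun x hi hj => hij (by
      have := hi.2.1.symm.trans hj.2.1
      exact Nat.succ_injective (Nat.cast_injective this))
  have d2 : Pairwise (Function.onFun Disjoint B₂) := fun i j hij =>
    Set.disjoint_left.2 fun x hi hj => hij (by
      have := hi.2.1.symm.trans hj.2.1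
      exact Nat.succ_injective (Nat.cast_injective this))
  have e1 : inducedMap T E ⁻¹' (Subtype.val ⁻¹' A) =
      Subtype.val ⁻¹' {x | T^[(returnTime T E x).toNat] x ∈ A} := rfl
  rw [e1, inducedMeasure_apply hE, inducedMeasure_apply hE]
  congr 1
  have u1 : (E ∩ {x | T^[(returnTime T E x).toNat] x ∈ A} : Set X) =ᵐ[μ] ⋃ n, B₁ n := by
    filter_upwards [h1] with x hx
    refine propext ?_
    change (x ∈ E ∧ T^[(returnTime T E x).toNat] x ∈ A) ↔ x ∈ ⋃ n, B₁ n
    simp only [Set.mem_iUnion, B₁, Set.mem_ofPred_eq]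
    constructor
    · rintro ⟨hxE, hA⟩
      obtain ⟨n, hn⟩ := Nat.exists_eq_succ_of_ne_zero (hx hxE)
      rw [hn] at hA
      exact ⟨n, hxE, (toNat_returnTime_eq_iff (by omega)).1 hn, hA⟩
    · rintro ⟨n, hxE, hr, hA⟩
      refine ⟨hxE, ?_⟩
      rwa [hr, ENat.toNat_natCast]
  have u2 : (E ∩ A : Set X) =ᵐ[μ] ⋃ n, B₂ n := by
    filter_upwards [h2] with x hx
    refine propext ?_
    change (x ∈ E ∧ x ∈ A) ↔ x ∈ ⋃ n, B₂ n
    simp only [Set.mem_iUnion, B₂, Set.mem_ofPred_eq]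
    constructor
    · rintro ⟨hxE, hA⟩
      obtain ⟨n, hn⟩ := Nat.exists_eq_succ_of_ne_zero (hx hxE)
      exact ⟨n, hxE, (toNat_returnTime_eq_iff (by omega)).1 hn, hA⟩
    · rintro ⟨n, hxE, hr, hA⟩
      exact ⟨hxE, hA⟩
  rw [measure_congr u1, measure_congr u2, measure_iUnion d1 m1, measure_iUnion d2 m2]
  refine tsum_congr fun n => ?_
  rw [hB]
  exact (hT.iterate (n + 1)).measure_preimage (m2 n).nullMeasurableSet

/-- The induced map of the inverse is the inverse of the induced map. -/
theorem inducedMap_symm_inducedMap (T : X ≃ᵐ X) {y : E} (h : returnTime T E y ≠ ⊤) :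
    inducedMap T.symm E (inducedMap T E y) = y ∧
      returnTime T.symm E (inducedMap T E y : X) = returnTime T E y := by
  obtain ⟨n, hn⟩ := ENat.ne_top_iff_exists.1 h
  have h1 : returnTime T.symm E (inducedMap T E y : X) = n :=
    (entryTime_eq_coe_iff T E _ n).2 ⟨y, rfl, hn.symm⟩
  refine ⟨Subtype.ext ?_, by rw [h1, hn]⟩
  have h2 : (inducedMap T E y : X) = T^[n] y := by simp [inducedMap, ← hn]
  change T.symm^[(returnTime T.symm E (inducedMap T E y : X)).toNat] (inducedMap T E y : X) = _
  rw [h1, ENat.toNat_natCast, h2, symm_iterate_iterate T le_rfl]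
  simp

theorem measure_ne_zero_of_sweepsOut {T : X → X} [IsProbabilityMeasure μ]
    (hT : MeasurePreserving T μ μ) (hE : MeasurableSet E) (h : SweepsOut μ T E) : μ E ≠ 0 := by
  intro h0
  have : μ (⋃ n : ℕ, T^[n] ⁻¹' E) = 0 := measure_iUnion_null fun n => by
    rw [(hT.iterate n).measure_preimage hE.nullMeasurableSet, h0]
  rw [SweepsOut, this] at h
  exact zero_ne_one h

theorem ae_exists_iterate_mem {T : X → X} [IsProbabilityMeasure μ] (hT : Measurable T)
    (hE : MeasurableSet E) (h : SweepsOut μ T E) : ∀ᵐ x ∂μ, ∃ n : ℕ, T^[n] x ∈ E := by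
  have hm : MeasurableSet (⋃ n : ℕ, T^[n] ⁻¹' E) :=
    MeasurableSet.iUnion fun n => hT.iterate n hE
  have := (prob_compl_eq_zero_iff hm).2 h
  filter_upwards [compl_mem_ae_iff.2 this] with x hx
  simpa using hx

/-- Almost every point has visited `E` in the past. -/
theorem ae_returnTime_symm_ne_top [IsProbabilityMeasure μ] (T : X ≃ᵐ X)
    (hT : MeasurePreserving T μ μ) (hE : MeasurableSet E) (h : SweepsOut μ T E) :
    ∀ᵐ x ∂μ, returnTime T.symm E x ≠ ⊤ := by
  have h1 : ∀ᵐ x ∂μ, ∀ m : ℕ, T^[m] x ∈ E → ∃ᶠ n in atTop, T.symm^[n] (T^[m] x) ∈ E :=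
    ae_all_iff.2 fun m => (hT.iterate m).quasiMeasurePreserving.ae
      (ae_mem_imp_frequently_iterate_mem (hT.symm T) hE)
  filter_upwards [h1, ae_exists_iterate_mem hT.measurable hE h] with x hx ⟨m, hm⟩
  -- A backward return from `T^m x` after more than `m` steps lies strictly in the past of `x`.
  obtain ⟨n, hn, hE⟩ := frequently_atTop.1 (hx m hm) (m + 1)
  refine returnTime_ne_top_iff.2 ⟨n - m, by omega, ?_⟩
  have : n = (n - m) + m := by omega
  rw [this, Function.iterate_add_apply, symm_iterate_iterate T le_rfl] at hE
  simpa using hE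

/-- Integration over `X` by columns: a sweeping set `E` is the top of a tower over which `X` is
spread by the inverse of `T`. -/
theorem lintegral_tower [IsProbabilityMeasure μ] (T : X ≃ᵐ X)
    (hT : MeasurePreserving T μ μ) (hE : MeasurableSet E) (h : SweepsOut μ T E)
    {g : X → ℝ≥0∞} (hg : Measurable g) :
    ∫⁻ y : E, ∑ j ∈ Finset.range (returnTime T.symm E y).toNat, g (T.symm^[j] y)
      ∂(inducedMeasure μ E) = (μ E)⁻¹ * ∫⁻ x, g x ∂μ := by
  rw [lintegral_inducedMeasure hE
    (fun y => ∑ j ∈ Finset.range (returnTime T.symm E y).toNat, g (T.symm^[j] y))]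
  congr 1
  have hTs : MeasurePreserving T.symm μ μ := hT.symm T
  -- `B j` is the level of the tower that first meets `E` after `j` steps, time `0` included. The
  -- levels partition `X` up to a null set, and `T^(-j) y` lies in `B j` exactly when `y ∈ E` and
  -- the column below `y` is higher than `j`.
  set B : ℕ → Set X := fun j => {x | T^[j] x ∈ E ∧ ∀ i < j, T^[i] x ∉ E} with hBdef
  have hBm : ∀ j, MeasurableSet (B j) := by
    intro j
    refine (T.measurable.iterate j hE).inter ?_
    have e : {x | ∀ i < j, T^[i] x ∉ E} = ⋂ m, ⋂ _ : m < j, (T^[m] ⁻¹' E)ᶜ := by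
      ext x
      simp
    change MeasurableSet {x | ∀ i < j, T^[i] x ∉ E}
    rw [e]
    exact MeasurableSet.iInter fun m => MeasurableSet.iInter fun _ =>
      (T.measurable.iterate m hE).compl
  have hBd : Pairwise (Function.onFun Disjoint B) := by
    intro i j hij
    refine Set.disjoint_left.2 fun x hi hj => ?_
    rcases lt_or_gt_of_ne hij with hlt | hlt
    · exact hj.2 i hlt hi.1
    · exact hi.2 j hlt hj.1
  have hBu : ∀ᵐ x ∂μ, x ∈ ⋃ j, B j := by
    classical
    filter_upwards [ae_exists_iterate_mem hT.measurable hE h] with x hx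
    exact Set.mem_iUnion.2 ⟨Nat.find hx, Nat.find_spec hx, fun i hi => Nat.find_min hx hi⟩
  have hBiff : ∀ y j, T.symm^[j] y ∈ B j ↔ y ∈ E ∧ (j : ℕ∞) < returnTime T.symm E y := by
    intro y j
    rw [lt_returnTime_iff]
    simp only [hBdef, Set.mem_ofPred_eq]
    rw [iterate_symm_iterate T le_rfl]
    simp only [Nat.sub_self, Function.iterate_zero, id]
    refine and_congr_right fun _ => ⟨fun H i h1 h2 => ?_, fun H i hi => ?_⟩
    · have := H (j - i) (by omega)
      rwa [iterate_symm_iterate T (by omega), show j - (j - i) = i by omega] at this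
    · rw [iterate_symm_iterate T (by omega)]
      exact H (j - i) (by omega) (by omega)
  calc ∫⁻ x in E, ∑ j ∈ Finset.range (returnTime T.symm E x).toNat, g (T.symm^[j] x) ∂μ
      = ∫⁻ x, ∑' j, (B j).indicator g (T.symm^[j] x) ∂μ := by
        rw [← lintegral_indicator hE]
        refine lintegral_congr_ae ?_
        filter_upwards [ae_mem_imp_returnTime_ne_top hTs hE] with x hx
        by_cases hxE : x ∈ E
        · rw [Set.indicator_of_mem hxE]
          obtain ⟨n, hn⟩ := ENat.ne_top_iff_exists.1 (hx hxE)
          rw [← hn, ENat.toNat_natCast, tsum_eq_sum (s := Finset.range n)]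
          · refine Finset.sum_congr rfl fun j hj => ?_
            rw [Set.indicator_of_mem]
            rw [hBiff, ← hn]
            exact ⟨hxE, by simpa using hj⟩
          · intro j hj
            rw [Set.indicator_of_notMem]
            rw [hBiff, ← hn]
            simpa [hxE] using hj
        · rw [Set.indicator_of_notMem hxE]
          symm
          refine ENNReal.tsum_eq_zero.2 fun j => ?_
          rw [Set.indicator_of_notMem]
          rw [hBiff]
          exact fun H => hxE H.1
    _ = ∑' j, ∫⁻ x, (B j).indicator g x ∂μ := by
        rw [lintegral_tsum (f := fun j x => (B j).indicator g (T.symm^[j] x)) fun j =>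
          ((hg.indicator (hBm j)).comp (hTs.measurable.iterate j)).aemeasurable]
        exact tsum_congr fun j => (hTs.iterate j).lintegral_comp (hg.indicator (hBm j))
    _ = ∫⁻ x in ⋃ j, B j, g x ∂μ := by
        rw [lintegral_iUnion hBm hBd]
        exact tsum_congr fun j => lintegral_indicator (hBm j) g
    _ = ∫⁻ x, g x ∂μ := by rw [Measure.restrict_eq_self_of_ae_mem hBu]

end Induced

/-! ### Finite itineraries -/

section Itinerary

variable {X A : Type*}

/-- The word `P(x), P(R x), …, P(R^{n-1} x)`. -/
def itinerary (R : X → X) (P : X → A) (n : ℕ) (x : X) : List A :=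
  (List.range n).map fun j => P (R^[j] x)

variable (R : X → X) (P : X → A)

@[simp] theorem itinerary_zero (x : X) : itinerary R P 0 x = [] := rfl

@[simp] theorem length_itinerary (n : ℕ) (x : X) : (itinerary R P n x).length = n := by
  simp [itinerary]

theorem itinerary_add (m n : ℕ) (x : X) :
    itinerary R P (m + n) x = itinerary R P m x ++ itinerary R P n (R^[m] x) := by
  simp only [itinerary, List.range_add, List.map_append, List.map_map]
  congr 1
  refine List.map_congr_left fun j _ => ?_
  simp only [Function.comp_apply]
  rw [add_comm, Function.iterate_add_apply]

theorem itinerary_succ (n : ℕ) (x : X) :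
    itinerary R P (n + 1) x = P x :: itinerary R P n (R x) := by
  rw [add_comm, itinerary_add]
  rfl

theorem itinerary_eq_ofFn (n : ℕ) (x : X) : itinerary R P n x = List.ofFn (join R P n x) := by
  induction n generalizing x with
  | zero => simp
  | succ n ih =>
    rw [itinerary_succ, List.ofFn_succ, ih]
    rfl

theorem itinerary_eq_iff {n : ℕ} {x x' : X} :
    itinerary R P n x = itinerary R P n x' ↔ ∀ j < n, P (R^[j] x) = P (R^[j] x') := by
  simp [itinerary]

theorem take_itinerary {m n : ℕ} (h : m ≤ n) (x : X) :
    (itinerary R P n x).take m = itinerary R P m x := by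
  obtain ⟨k, rfl⟩ := Nat.exists_eq_add_of_le h
  rw [itinerary_add, List.take_left' (by simp)]

theorem drop_itinerary {m n : ℕ} (h : m ≤ n) (x : X) :
    (itinerary R P n x).drop m = itinerary R P (n - m) (R^[m] x) := by
  obtain ⟨k, rfl⟩ := Nat.exists_eq_add_of_le h
  rw [itinerary_add, List.drop_left' (by simp), Nat.add_sub_cancel_left]

variable {R P}

theorem measCells_itinerary [MeasurableSpace X] [Countable A] (hP : MeasCells P)
    (hR : Measurable R) (n : ℕ) : MeasCells (itinerary R P n) := by
  have : itinerary R P n = fun x => List.ofFn (join R P n x) :=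
    funext (itinerary_eq_ofFn R P n)
  rw [this]
  exact (hP.join hR n).comp _

theorem condEntropy_itinerary [MeasurableSpace X] (μ : Measure X) [IsProbabilityMeasure μ]
    (n : ℕ) : condEntropy μ P (fun x => itinerary R P n (R x)) =
      condEntropy μ P (fun x => join R P n (R x)) := by
  simp only [itinerary_eq_ofFn]
  exact condEntropy_comp_injective (List.ofFn_injective (n := n)) P fun x => join R P n (R x)

end Itinerary

/-! ### Predicting a word letter by letter -/

section WordProb

variable {A : Type*}

/-- The probability of the word `w` before the context `l`, if letters are added at the head of the
word with probabilities given by `q`. -/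
def wordProb (q : List A → A → ℝ) (l : List A) : List A → ℝ
  | [] => 1
  | a :: w => q (w ++ l) a * wordProb q l w

theorem wordProb_nonneg {q : List A → A → ℝ} (hq : ∀ l a, 0 ≤ q l a) (l w : List A) :
    0 ≤ wordProb q l w := by
  induction w with
  | nil => exact zero_le_one
  | cons a w ih => exact mul_nonneg (hq _ _) ih

theorem wordProb_le_one {q : List A → A → ℝ} (hq : ∀ l a, 0 ≤ q l a) (hq1 : ∀ l a, q l a ≤ 1)
    (l w : List A) : wordProb q l w ≤ 1 := by
  induction w with
  | nil => exact le_rfl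
  | cons a w ih => exact mul_le_one₀ (hq1 _ _) (wordProb_nonneg hq _ _) ih

/-- Information is additive over the product that defines `wordProb`. The rest of the word and its
context join to a single itinerary, from which letter `j` is predicted. -/
theorem info_wordProb {X : Type*} (R : X → X) (P : X → A) {q : List A → A → ℝ}
    (hq : ∀ l a, 0 ≤ q l a) (hq1 : ∀ l a, q l a ≤ 1) (L k : ℕ) (x : X) :
    info (wordProb q (itinerary R P L (R^[k] x)) (itinerary R P k x)) =
      ∑ j ∈ Finset.range k, info (q (itinerary R P (k - 1 - j + L) (R^[j + 1] x)) (P (R^[j] x))) := by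
  induction k generalizing x with
  | zero => simp [wordProb]
  | succ k ih =>
    rw [itinerary_succ, wordProb, info_mul (hq _ _) (hq1 _ _) (wordProb_nonneg hq _ _)
      (wordProb_le_one hq hq1 _ _), Function.iterate_succ_apply, ih, ← itinerary_add,
      Finset.sum_range_succ', add_comm]
    congr 1
    refine Finset.sum_congr rfl fun j _ => ?_
    rw [show k + 1 - 1 - (j + 1) = k - 1 - j by omega]
    rfl

variable {κ : Type*}

/-- A word whose first letter is starred and whose other letters are not. -/
def IsReturnWord (w : List (κ × Bool)) : Prop :=
  ∃ a u, w = a :: u ∧ a.2 = true ∧ ∀ b ∈ u, b.2 = false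

theorem tsum_list_eq {f : List A → ℝ≥0∞} (h : f [] = 0) :
    ∑' w, f w = ∑' u, ∑' a, f (a :: u) := by
  have hinj : (fun p : List A × A => p.2 :: p.1).Injective := by
    rintro ⟨u, a⟩ ⟨v, b⟩ hab
    simp only [List.cons.injEq] at hab
    simp [hab]
  rw [← hinj.tsum_eq, ENNReal.tsum_prod (f := fun u a => f (a :: u))]
  intro w hw
  cases w with
  | nil => exact absurd h hw
  | cons a u => exact ⟨(u, a), rfl⟩

open Classical in
-- A stopping-time argument: words grow at the head until a starred letter appears. Let `U n` be the
-- mass of the star-free words of length `n` and `V n` that of the return words of length `n`. One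
-- more letter gives `V (n + 1) + U (n + 1) ≤ U n`, and the sum of `V` telescopes to at most `U 0 =
-- 1`.
theorem tsum_wordProb_le {q : List (κ × Bool) → κ × Bool → ℝ} (hq : ∀ l a, 0 ≤ q l a)
    (hsum : ∀ l, ∑' a, ENNReal.ofReal (q l a) ≤ 1) (l : List (κ × Bool)) :
    ∑' w, ENNReal.ofReal (if IsReturnWord w then wordProb q l w else 0) ≤ 1 := by
  set p : List (κ × Bool) → ℝ≥0∞ := fun w => ENNReal.ofReal (wordProb q l w) with hp
  have hpc : ∀ a u, p (a :: u) = ENNReal.ofReal (q (u ++ l) a) * p u := fun a u =>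
    ENNReal.ofReal_mul (hq _ _)
  set U : ℕ → ℝ≥0∞ := fun n => ∑' w : List (κ × Bool),
    if w.length = n ∧ ∀ b ∈ w, b.2 = false then p w else 0 with hU
  set V : ℕ → ℝ≥0∞ := fun n => ∑' w : List (κ × Bool),
    if w.length = n ∧ IsReturnWord w then p w else 0 with hV
  have hstep : ∀ n, V (n + 1) + U (n + 1) ≤ U n := by
    intro n
    simp only [hU, hV]
    rw [tsum_list_eq (f := fun w => if w.length = n + 1 ∧ IsReturnWord w then p w else 0)
      (by simp), tsum_list_eq (f := fun w =>
        if w.length = n + 1 ∧ ∀ b ∈ w, b.2 = false then p w else 0) (by simp), ← ENNReal.tsum_add]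
    refine ENNReal.tsum_le_tsum fun u => ?_
    rw [← ENNReal.tsum_add]
    have : ∀ a, ((if (a :: u).length = n + 1 ∧ IsReturnWord (a :: u) then p (a :: u) else 0) +
        if (a :: u).length = n + 1 ∧ ∀ b ∈ a :: u, b.2 = false then p (a :: u) else 0) ≤
        ENNReal.ofReal (q (u ++ l) a) *
          if u.length = n ∧ ∀ b ∈ u, b.2 = false then p u else 0 := by
      intro a
      have e1 : ((a :: u).length = n + 1 ∧ IsReturnWord (a :: u)) ↔
          (u.length = n ∧ ∀ b ∈ u, b.2 = false) ∧ a.2 = true := by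
        simp only [IsReturnWord, List.length_cons, List.cons.injEq]
        constructor
        · rintro ⟨h1, _, _, ⟨rfl, rfl⟩, h2, h3⟩
          exact ⟨⟨by omega, h3⟩, h2⟩
        · rintro ⟨⟨h1, h3⟩, h2⟩
          exact ⟨by omega, a, u, ⟨rfl, rfl⟩, h2, h3⟩
      have e2 : ((a :: u).length = n + 1 ∧ ∀ b ∈ a :: u, b.2 = false) ↔
          (u.length = n ∧ ∀ b ∈ u, b.2 = false) ∧ a.2 = false := by
        simp only [List.length_cons, List.mem_cons, forall_eq_or_imp]
        constructor
        · rintro ⟨h1, h2, h3⟩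
          exact ⟨⟨by omega, h3⟩, h2⟩
        · rintro ⟨⟨h1, h3⟩, h2⟩
          exact ⟨by omega, h2, h3⟩
      rw [if_congr e1 rfl rfl, if_congr e2 rfl rfl, hpc]
      by_cases hu : u.length = n ∧ ∀ b ∈ u, b.2 = false
      · cases ha : a.2 <;> simp [hu]
      · rw [if_neg hu, if_neg fun h => hu h.1, if_neg fun h => hu h.1]
        simp
    refine (ENNReal.tsum_le_tsum this).trans ?_
    rw [ENNReal.tsum_mul_right]
    exact mul_le_of_le_one_left' (hsum _)
  have hU0 : U 0 = 1 := by
    simp only [hU]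
    rw [tsum_eq_single []]
    · simp [hp, wordProb]
    · intro w hw
      simp [hw]
  have hV0 : V 0 = 0 := by
    refine ENNReal.tsum_eq_zero.2 fun w => if_neg ?_
    rintro ⟨h, a, u, rfl, -⟩
    simp at h
  have hpart : ∀ n, (∑ i ∈ Finset.range (n + 1), V i) + U n ≤ 1 := by
    intro n
    induction n with
    | zero => simp [hU0, hV0]
    | succ n ih =>
      rw [Finset.sum_range_succ, add_assoc]
      exact (add_le_add_right (hstep n) _).trans ih
  have hVsum : ∑' n, V n ≤ 1 := by
    refine ENNReal.tsum_le_of_sum_range_le fun n => ?_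
    refine le_trans ?_ ((le_self_add).trans (hpart n))
    exact Finset.sum_le_sum_of_subset (Finset.range_mono (by omega))
  refine le_trans (le_of_eq ?_) hVsum
  simp only [hV]
  rw [ENNReal.tsum_comm]
  refine tsum_congr fun w => ?_
  rw [tsum_eq_single w.length]
  · by_cases h : IsReturnWord w <;> simp [h, hp]
  · intro n hn
    rw [if_neg]
    rintro ⟨h, -⟩
    exact hn h.symm

/-- Revealing a word letter by letter costs at most its total information content. -/
theorem sum_info_div_le {f : List A → ℝ} (hf : ∀ w, 0 ≤ f w)
    (hmono : ∀ a w, f (a :: w) ≤ f w) (w : List A) :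
    ∑ j ∈ Finset.range w.length, info (f (w.drop j) / f (w.drop (j + 1))) ≤ info (f w / f []) := by
  have hnil : ∀ w, f w ≤ f [] := by
    intro w
    induction w with
    | nil => exact le_rfl
    | cons a w ih => exact (hmono a w).trans ih
  induction w with
  | nil => simp
  | cons a u ih =>
    rw [List.length_cons, Finset.sum_range_succ']
    simp only [List.drop_succ_cons, List.drop_zero]
    refine (add_le_add_left ih _).trans (le_of_eq ?_)
    rw [add_comm, ← info_mul (div_nonneg (hf _) (hf _)) (div_le_one_of_le₀ (hmono _ _) (hf _))
      (div_nonneg (hf _) (hf _)) (div_le_one_of_le₀ (hnil _) (hf _))]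
    congr 1
    rcases eq_or_lt_of_le (hf u) with h0 | h0
    · have : f (a :: u) = 0 := le_antisymm ((hmono a u).trans h0.symm.le) (hf _)
      simp [← h0, this]
    · field_simp

end WordProb

/-! ### Words since the previous visit -/

section Words

variable {X κ : Type*} [MeasurableSpace X] (T : X ≃ᵐ X) (E : Set X) (Q : X → κ)

/-- The letters read backwards from `x` until the previous visit to `E`. -/
def backWord (x : X) : List (κ × Bool) :=
  itinerary T.symm (hatPartition E Q) (returnTime T.symm E x).toNat x

/-- The previous visit to `E`. -/
def backStep (x : X) : X := T.symm^[(returnTime T.symm E x).toNat] x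

theorem backStep_coe (y : E) : backStep T E y = (inducedMap T.symm E y : X) := rfl

variable {T E Q}

theorem length_backWord (x : X) :
    (backWord T E Q x).length = (returnTime T.symm E x).toNat := length_itinerary _ _ _ _

omit [MeasurableSpace X] in
theorem hatPartition_snd (x : X) : (hatPartition E Q x).2 = true ↔ x ∈ E := by
  simp [hatPartition]

theorem isReturnWord_backWord {x : X} (hx : x ∈ E) (h : returnTime T.symm E x ≠ ⊤) :
    IsReturnWord (backWord T E Q x) := by
  have h0 : (returnTime T.symm E x).toNat ≠ 0 := fun h0 => h (returnTime_toNat_eq_zero_iff.1 h0)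
  obtain ⟨n, hn⟩ := Nat.exists_eq_succ_of_ne_zero h0
  have hmin := (returnTime_eq_coe_iff.1 (ENat.natCast_toNat h).symm).2
  refine ⟨hatPartition E Q x, itinerary T.symm (hatPartition E Q) n (T.symm x), ?_, ?_, ?_⟩
  · rw [backWord, hn, itinerary_succ]
  · exact (hatPartition_snd x).2 hx
  · intro b hb
    simp only [itinerary, List.mem_map, List.mem_range] at hb
    obtain ⟨j, hj, rfl⟩ := hb
    rw [← Bool.not_eq_true, hatPartition_snd]
    intro hmem
    exact hmin (j + 1) (by omega) ⟨by omega, hmem⟩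

theorem backWord_eq_cons {x : X} (h : returnTime T.symm E x ≠ ⊤) :
    backWord T E Q x = hatPartition E Q x :: (backWord T E Q x).tail := by
  have h0 : (returnTime T.symm E x).toNat ≠ 0 := fun h0 => h (returnTime_toNat_eq_zero_iff.1 h0)
  obtain ⟨n, hn⟩ := Nat.exists_eq_succ_of_ne_zero h0
  rw [backWord, hn, itinerary_succ, List.tail_cons]

theorem measCells_hatPartition [MeasurableSpace κ] [DiscreteMeasurableSpace κ]
    (hE : MeasurableSet E) (hQ : Measurable Q) : MeasCells (hatPartition E Q) := by
  refine MeasCells.prodMk (fun a => hQ (.of_discrete)) fun b => ?_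
  cases b
  · convert hE.compl using 1
    ext x
    simp
  · convert hE using 1
    ext x
    simp

theorem measCells_backWord [Countable κ] [MeasurableSpace κ] [DiscreteMeasurableSpace κ]
    (hE : MeasurableSet E) (hQ : Measurable Q) : MeasCells (backWord T E Q) := by
  have h1 := measCells_returnTime T.symm.measurable hE
  intro w
  -- On the cell of `w` the length is known to be `w.length`, which replaces the variable length by
  -- a fixed one.
  have : backWord T E Q ⁻¹' {w} = (fun x => ((returnTime T.symm E x).toNat,
      itinerary T.symm (hatPartition E Q) w.length x)) ⁻¹' {(w.length, w)} := by
    ext x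
    simp only [Set.mem_preimage, Set.mem_singleton_iff, Prod.mk.injEq]
    constructor
    · rintro rfl
      rw [length_backWord]
      exact ⟨rfl, rfl⟩
    · rintro ⟨e1, e2⟩
      rw [backWord, e1, e2]
  rw [this]
  exact ((h1.comp ENat.toNat).prodMk
    (measCells_itinerary (measCells_hatPartition hE hQ) T.symm.measurable _)) _

theorem measurable_backStep (hE : MeasurableSet E) : Measurable (backStep T E) := by
  have h1 : Measurable fun p : ℕ × X => T.symm^[p.1] p.2 :=
    measurable_from_prod_countable_right fun n => T.symm.measurable.iterate n
  have h2 := (measCells_returnTime T.symm.measurable hE).measurable_comp ENat.toNat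
  exact h1.comp (h2.prodMk measurable_id)

/-- Going back inside a column. -/
theorem returnTime_symm_iterate {x : X} {j n : ℕ} (h : returnTime T.symm E x = n) (hj : j < n) :
    returnTime T.symm E (T.symm^[j] x) = (n - j : ℕ) := by
  obtain ⟨⟨h1, h2⟩, h3⟩ := returnTime_eq_coe_iff.1 h
  rw [returnTime_eq_coe_iff]
  refine ⟨⟨by omega, ?_⟩, fun m hm hm' => h3 (m + j) (by omega) ⟨by omega, ?_⟩⟩
  · rwa [← Function.iterate_add_apply, show n - j + j = n by omega]
  · rw [Function.iterate_add_apply]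
    exact hm'.2

theorem backWord_iterate {x : X} {j : ℕ} (hj : j < (returnTime T.symm E x).toNat) :
    backWord T E Q (T.symm^[j] x) = (backWord T E Q x).drop j ∧
      backStep T E (T.symm^[j] x) = backStep T E x := by
  have h : returnTime T.symm E x ≠ ⊤ := by
    intro h
    simp [h] at hj
  have h1 := returnTime_symm_iterate (ENat.natCast_toNat h).symm hj
  constructor
  · rw [backWord, h1, ENat.toNat_natCast, backWord, drop_itinerary _ _ hj.le]
  · rw [backStep, h1, ENat.toNat_natCast, backStep, ← Function.iterate_add_apply,
      Nat.sub_add_cancel hj.le]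

/-- The words of consecutive visits add up to an itinerary of `T⁻¹`. -/
theorem exists_flatten_itinerary (N : ℕ) (x : X)
    (h : ∀ n, returnTime T.symm E (T.symm^[n] x) ≠ ⊤) :
    ∃ L, N ≤ L ∧ (itinerary (backStep T E) (backWord T E Q) N x).flatten =
      itinerary T.symm (hatPartition E Q) L x := by
  induction N generalizing x with
  | zero => exact ⟨0, le_rfl, rfl⟩
  | succ N ih =>
    obtain ⟨L, hL, e⟩ := ih (backStep T E x) fun n => by
      rw [backStep, ← Function.iterate_add_apply]
      exact h _
    have h0 : (returnTime T.symm E x).toNat ≠ 0 := fun h0 =>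
      h 0 (returnTime_toNat_eq_zero_iff.1 h0)
    -- Every word has at least one letter, so `N` words supply at least `N` letters.
    refine ⟨(returnTime T.symm E x).toNat + L, by omega, ?_⟩
    rw [itinerary_succ, List.flatten_cons, e, itinerary_add]
    rfl

theorem itinerary_inducedMap (N : ℕ) (y : E) :
    itinerary (inducedMap T.symm E) (fun y : E => backWord T E Q y) N y =
      itinerary (backStep T E) (backWord T E Q) N y := by
  induction N generalizing y with
  | zero => rfl
  | succ N ih => rw [itinerary_succ, itinerary_succ, ih, backStep_coe]

/-- The number of letters before `x` up to the visit number `M + 1` in the past. -/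
def pastVisit (T : X ≃ᵐ X) (E : Set X) : ℕ → X → ℕ∞
  | 0, x => returnTime T.symm E x
  | M + 1, x => returnTime T.symm E x + pastVisit T E M (backStep T E x)

theorem returnTime_le_pastVisit (M : ℕ) (x : X) :
    returnTime T.symm E x ≤ pastVisit T E M x := by
  cases M with
  | zero => exact le_rfl
  | succ M => exact le_self_add

theorem measCells_pastVisit (hE : MeasurableSet E) (M : ℕ) : MeasCells (pastVisit T E M) := by
  induction M with
  | zero => exact measCells_returnTime T.symm.measurable hE
  | succ M ih =>
    exact ((measCells_returnTime T.symm.measurable hE).prodMk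
      (ih.comp_measurable (measurable_backStep hE))).comp fun p => p.1 + p.2

theorem pastVisit_ne_top (M : ℕ) (x : X) (h : ∀ n, returnTime T.symm E (T.symm^[n] x) ≠ ⊤) :
    pastVisit T E M x ≠ ⊤ := by
  induction M generalizing x with
  | zero => exact h 0
  | succ M ih =>
    refine WithTop.add_ne_top.2 ⟨h 0, ih _ fun n => ?_⟩
    rw [backStep, ← Function.iterate_add_apply]
    exact h _

theorem returnTime_symm_congr {x x' : X} {n : ℕ} (h : returnTime T.symm E x = n)
    (hx : ∀ j, 1 ≤ j → j ≤ n →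
      hatPartition E Q (T.symm^[j] x) = hatPartition E Q (T.symm^[j] x')) :
    returnTime T.symm E x' = n := by
  refine returnTime_congr h fun j h1 h2 => ?_
  rw [← hatPartition_snd (Q := Q), hx j h1 h2, hatPartition_snd]

/-- If the past visits of `x` are visible in the last `L` letters, these letters determine the
current partial word and the preceding words. -/
theorem past_congr (M L : ℕ) (x x' : X) (hτ : pastVisit T E M x ≤ L)
    (hx : ∀ j, 1 ≤ j → j ≤ L →
      hatPartition E Q (T.symm^[j] x) = hatPartition E Q (T.symm^[j] x')) :
    pastVisit T E M x' = pastVisit T E M x ∧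
      (backWord T E Q x').tail = (backWord T E Q x).tail ∧
      itinerary (backStep T E) (backWord T E Q) M (backStep T E x') =
        itinerary (backStep T E) (backWord T E Q) M (backStep T E x) := by
  induction M generalizing L x x' with
  | zero =>
    obtain ⟨n, hn⟩ := ENat.ne_top_iff_exists.1 (ne_top_of_le_ne_top (ENat.natCast_ne_top L) hτ)
    have hn : returnTime T.symm E x = n := hn.symm
    have hnL : n ≤ L := by
      have : ((n : ℕ) : ℕ∞) ≤ L := hn ▸ hτ
      exact_mod_cast this
    have hn' := returnTime_symm_congr hn fun j h1 h2 => hx j h1 (h2.trans hnL)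
    refine ⟨hn'.trans hn.symm, ?_, rfl⟩
    have h1 := (returnTime_eq_coe_iff.1 hn).1.1
    obtain ⟨m, rfl⟩ := Nat.exists_eq_add_of_le' h1
    rw [backWord, backWord, hn, hn', ENat.toNat_natCast, itinerary_succ, itinerary_succ,
      List.tail_cons, List.tail_cons, itinerary_eq_iff]
    exact fun j hj => (hx (j + 1) (by omega) (by omega)).symm
  | succ M ih =>
    have hk : returnTime T.symm E x ≤ L := le_trans le_self_add hτ
    obtain ⟨n, hn⟩ := ENat.ne_top_iff_exists.1 (ne_top_of_le_ne_top (ENat.natCast_ne_top L) hk)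
    have hn : returnTime T.symm E x = n := hn.symm
    have hnL : n ≤ L := by
      rw [hn] at hk
      exact_mod_cast hk
    have hn' := returnTime_symm_congr hn fun j h1 h2 => hx j h1 (h2.trans hnL)
    have h1 := (returnTime_eq_coe_iff.1 hn).1.1
    have b : backStep T E x = T.symm^[n] x := by rw [backStep, hn, ENat.toNat_natCast]
    have b' : backStep T E x' = T.symm^[n] x' := by rw [backStep, hn', ENat.toNat_natCast]
    have hτ' : pastVisit T E M (backStep T E x) ≤ (L - n : ℕ) := by
      change returnTime T.symm E x + pastVisit T E M (backStep T E x) ≤ L at hτ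
      rw [hn] at hτ
      obtain ⟨k, hk⟩ := ENat.ne_top_iff_exists.1
        (ne_top_of_le_ne_top (ENat.natCast_ne_top L) (le_trans le_add_self hτ))
      rw [← hk] at hτ ⊢
      have : n + k ≤ L := by exact_mod_cast hτ
      exact_mod_cast (by omega : k ≤ L - n)
    obtain ⟨i1, i2, i3⟩ := ih (L - n) (backStep T E x) (backStep T E x') hτ' fun j h2 h3 => by
      rw [b, b', ← Function.iterate_add_apply, ← Function.iterate_add_apply]
      exact hx _ (by omega) (by omega)
    have hne : returnTime T.symm E (backStep T E x) ≠ ⊤ :=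
      ne_top_of_le_ne_top (ENat.natCast_ne_top _) ((returnTime_le_pastVisit M _).trans hτ')
    have hne' : returnTime T.symm E (backStep T E x') ≠ ⊤ :=
      ne_top_of_le_ne_top (ENat.natCast_ne_top _)
        ((returnTime_le_pastVisit M _).trans (i1.le.trans hτ'))
    refine ⟨?_, ?_, ?_⟩
    · change returnTime T.symm E x' + _ = returnTime T.symm E x + _
      rw [hn, hn', i1]
    · obtain ⟨m, rfl⟩ := Nat.exists_eq_add_of_le' h1
      rw [backWord, backWord, hn, hn', ENat.toNat_natCast, itinerary_succ, itinerary_succ,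
        List.tail_cons, List.tail_cons, itinerary_eq_iff]
      exact fun j hj => (hx (j + 1) (by omega) (by omega)).symm
    -- The tail of the first preceding word comes from the induction hypothesis; its head is letter
    -- `n` of the window, at the visit itself.
    · rw [itinerary_succ, itinerary_succ, i3, backWord_eq_cons hne, backWord_eq_cons hne', i2,
        b, b', hx n h1 hnL]

end Words

/-! ### Comparison of the entropies -/

section Comparison

variable {X κ : Type*} [MeasurableSpace X] {μ : Measure X} [IsProbabilityMeasure μ] {T : X ≃ᵐ X}
  {E : Set X} [Finite κ] [MeasurableSpace κ] [DiscreteMeasurableSpace κ] {Q : X → κ}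

theorem ae_forall_returnTime_symm_ne_top (hT : MeasurePreserving T μ μ)
    (hE : MeasurableSet E) (hsweep : SweepsOut μ T E) :
    ∀ᵐ x ∂μ, ∀ n, returnTime T.symm E (T.symm^[n] x) ≠ ⊤ :=
  ae_all_iff.2 fun n => ((hT.symm T).iterate n).quasiMeasurePreserving.ae
    (ae_returnTime_symm_ne_top T hT hE hsweep)

/-- The cost of predicting the words of `E` letter by letter. -/
theorem lintegral_info_backWord (hT : MeasurePreserving T μ μ) (hE : MeasurableSet E)
    (hsweep : SweepsOut μ T E) (hQ : Measurable Q) {N : ℕ}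
    {q : List (κ × Bool) → κ × Bool → ℝ} (hq : ∀ l a, 0 ≤ q l a)
    (hsum : ∀ l, ∑' a, ENNReal.ofReal (q l a) ≤ 1) (hN : ∀ l, q (l.take N) = q l) :
    open Classical in
    ∫⁻ y : E, info (if IsReturnWord (backWord T E Q y) then
      wordProb q (itinerary (backStep T E) (backWord T E Q) N (backStep T E y)).flatten
        (backWord T E Q y) else 0) ∂(inducedMeasure μ E) =
    (μ E)⁻¹ * ∫⁻ x, info (q (itinerary T.symm (hatPartition E Q) N (T.symm x))
      (hatPartition E Q x)) ∂μ := by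
  have hq1 : ∀ l a, q l a ≤ 1 := fun l a =>
    ENNReal.ofReal_le_one.1 ((ENNReal.le_tsum a).trans (hsum l))
  have hm := measCells_hatPartition (κ := κ) hE hQ
  have hmg : Measurable fun x => info (q (itinerary T.symm (hatPartition E Q) N (T.symm x))
      (hatPartition E Q x)) :=
    (((measCells_itinerary hm T.symm.measurable N).comp_measurable T.symm.measurable).prodMk
      hm).measurable_comp fun p => info (q p.1 p.2)
  rw [← lintegral_tower T hT hE hsweep hmg]
  refine lintegral_congr_ae ?_
  refine (ae_inducedMeasure hE ((ae_forall_returnTime_symm_ne_top hT hE hsweep).mono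
    fun x hx _ => hx)).mono fun y hy => ?_
  obtain ⟨L, hL, e⟩ := exists_flatten_itinerary (Q := Q) N (backStep T E y) fun n => by
    rw [backStep, ← Function.iterate_add_apply]
    exact hy _
  simp only
  rw [if_pos (isReturnWord_backWord y.2 (hy 0)), e, backWord, backStep, info_wordProb _ _ hq hq1]
  refine Finset.sum_congr rfl fun j _ => ?_
  -- The context has `L ≥ N` letters, so truncation leaves exactly the `N` predecessors of letter
  -- `j`.
  rw [← hN, take_itinerary _ _ (by omega), Function.iterate_succ_apply']

theorem tsum_uniform_le_one (κ : Type*) [Finite κ] :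
    ∑' _ : κ × Bool, ENNReal.ofReal ((Nat.card (κ × Bool) : ℝ)⁻¹) ≤ 1 := by
  have := Fintype.ofFinite κ
  rcases isEmpty_or_nonempty κ with h | h
  · simp
  rw [tsum_fintype, Finset.sum_const, Finset.card_univ, nsmul_eq_mul,
    Nat.card_eq_fintype_card, ENNReal.ofReal_inv_of_pos (by exact_mod_cast Fintype.card_pos),
    ENNReal.ofReal_natCast]
  exact ENNReal.mul_inv_le_one _

theorem info_uniform_ne_top (κ : Type*) [Finite κ] [Nonempty κ] :
    info ((Nat.card (κ × Bool) : ℝ)⁻¹) ≠ ∞ := by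
  rw [info_of_ne (inv_ne_zero (by exact_mod_cast Nat.card_pos.ne'))]
  exact ENNReal.ofReal_ne_top

/-- With uniform letters and no context, a word costs its length times the logarithm of the alphabet
size. By the tower formula the mean cost is this logarithm divided by `μ E`. -/
theorem staticEntropy_adapted_lt_top (hT : MeasurePreserving T μ μ) (hE : MeasurableSet E)
    (hsweep : SweepsOut μ T E) (hQ : Measurable Q) :
    staticEntropy (inducedMeasure μ E) (fun y : E => backWord T E Q y) < ∞ := by
  classical
  have h0 := measure_ne_zero_of_sweepsOut hT hE hsweep
  have := isProbabilityMeasure_inducedMeasure hE h0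
  have : Nonempty X := nonempty_of_isProbabilityMeasure μ
  have : Nonempty κ := this.map Q
  set c : ℝ := (Nat.card (κ × Bool) : ℝ)⁻¹
  have hc : ∀ (l : List (κ × Bool)) (a : κ × Bool), 0 ≤ (fun _ _ => c : _ → _ → ℝ) l a :=
    fun _ _ => by positivity
  have hs : ∀ l : List (κ × Bool), ∑' a : κ × Bool,
      ENNReal.ofReal ((fun _ _ => c : List (κ × Bool) → κ × Bool → ℝ) l a) ≤ 1 :=
    fun _ => tsum_uniform_le_one κ
  have h1 := staticEntropy_le_lintegral_info (μ := inducedMeasure μ E)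
    ((measCells_backWord (T := T) hE hQ).comp_measurable measurable_subtype_coe)
    (fun w => by
      split_ifs
      exacts [wordProb_nonneg hc [] w, le_rfl])
    (tsum_wordProb_le hc hs [])
  refine h1.trans_lt ?_
  have h2 := lintegral_info_backWord hT hE hsweep hQ (N := 0) hc hs (fun _ => rfl)
  simp only [itinerary_zero, List.flatten_nil] at h2
  rw [h2]
  simp only [lintegral_const, measure_univ, mul_one]
  exact ENNReal.mul_lt_top (ENNReal.inv_lt_top.2 (pos_iff_ne_zero.2 h0))
    (info_uniform_ne_top κ).lt_top

theorem measure_mul_condEntropy_le (hT : MeasurePreserving T μ μ) (hE : MeasurableSet E)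
    (hsweep : SweepsOut μ T E) (hQ : Measurable Q) (N : ℕ) :
    μ E * condEntropy (inducedMeasure μ E) (fun y : E => backWord T E Q y)
      (fun y => itinerary (inducedMap T.symm E) (fun y : E => backWord T E Q y) N
        (inducedMap T.symm E y)) ≤
    condEntropy μ (hatPartition E Q)
      (fun x => itinerary T.symm (hatPartition E Q) N (T.symm x)) := by
  classical
  have h0 := measure_ne_zero_of_sweepsOut hT hE hsweep
  have := isProbabilityMeasure_inducedMeasure hE h0
  have hm := measCells_hatPartition (κ := κ) hE hQ
  have hmi := measCells_itinerary hm T.symm.measurable N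
  have hmw : MeasCells fun y : E => backWord T E Q y :=
    (measCells_backWord (T := T) hE hQ).comp_measurable measurable_subtype_coe
  have hS := measurePreserving_inducedMap T.symm (hT.symm T) hE
  have hmz := measCells_itinerary hmw hS.measurable N
  -- The truncation lets the predictor accept the longer context that `N` flattened words provide.
  set q : List (κ × Bool) → κ × Bool → ℝ := fun l => condProb μ (hatPartition E Q)
    (fun x => itinerary T.symm (hatPartition E Q) N (T.symm x)) (l.take N) with hqdef
  have hq : ∀ l a, 0 ≤ q l a := fun l a => condProb_nonneg _ _ _ _
  have hs : ∀ l, ∑' a, ENNReal.ofReal (q l a) ≤ 1 := fun l =>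
    tsum_condProb_le hm (hmi.comp_measurable T.symm.measurable) _
  have hfin : staticEntropy (inducedMeasure μ E) (fun y : E => itinerary (inducedMap T.symm E)
      (fun y : E => backWord T E Q y) N (inducedMap T.symm E y)) ≠ ∞ := by
    rw [staticEntropy_comp_measurePreserving hmz hS]
    simp only [funext (itinerary_eq_ofFn (inducedMap T.symm E) (fun y : E => backWord T E Q y) N)]
    rw [staticEntropy_comp_injective (List.ofFn_injective (n := N))]
    exact staticEntropy_join_ne_top hmw hS (staticEntropy_adapted_lt_top hT hE hsweep hQ).ne N
  have h1 := condEntropy_le hmw (hmz.comp_measurable hS.measurable) hfin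
    (q := fun z w => if IsReturnWord w then wordProb q z.flatten w else 0)
    (fun z w => by
      split_ifs
      exacts [wordProb_nonneg hq _ w, le_rfl])
    (fun z => tsum_wordProb_le hq hs z.flatten)
  have h2 := lintegral_info_backWord hT hE hsweep hQ (N := N) hq hs
    (fun l => by simp only [hqdef, List.take_take, min_self])
  simp only [itinerary_inducedMap, ← backStep_coe] at h1 ⊢
  rw [h2] at h1
  refine (mul_le_mul_right h1 _).trans ?_
  rw [← mul_assoc, ENNReal.mul_inv_cancel h0 (measure_ne_top _ _), one_mul]
  refine le_of_eq (lintegral_congr fun x => ?_)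
  simp only [hqdef]
  rw [List.take_of_length_le (by simp)]

end Comparison

/-! ### The opposite inequality: letters predicted from return words -/

section Comparison

variable {X κ : Type*} [MeasurableSpace X] {μ : Measure X} [IsProbabilityMeasure μ] {T : X ≃ᵐ X}
  {E : Set X} [Finite κ] [MeasurableSpace κ] [DiscreteMeasurableSpace κ] {Q : X → κ}

/-- The joint probability that `W` ends with the word `u` and that `Z` has the label `z`. -/
def suffixProb {Y A Γ : Type*} [MeasurableSpace Y] (ν : Measure Y) (W : Y → List A) (Z : Y → Γ)
    (z : Γ) (u : List A) : ℝ :=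
  ν.real {y | u <:+ W y ∧ Z y = z}

section SuffixProb

variable {Y A Γ : Type*} [MeasurableSpace Y] {ν : Measure Y} [IsProbabilityMeasure ν]
  {W : Y → List A} {Z : Y → Γ}

omit [IsProbabilityMeasure ν] in
theorem suffixProb_nonneg (z : Γ) (u : List A) : 0 ≤ suffixProb ν W Z z u :=
  measureReal_nonneg

theorem suffixProb_cons_le (z : Γ) (a : A) (u : List A) :
    suffixProb ν W Z z (a :: u) ≤ suffixProb ν W Z z u :=
  measureReal_mono fun _ hy => ⟨(List.suffix_cons a u).trans hy.1, hy.2⟩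

/-- The event that `W` equals `w` lies in the event that `W` ends with `w`, and the empty word is a
suffix of everything. -/
theorem info_suffixProb_le (z : Γ) (w : List A) :
    info (suffixProb ν W Z z w / suffixProb ν W Z z []) ≤ info (condProb ν W Z z w) := by
  refine info_anti (condProb_nonneg _ _ _ _) ?_
  have h0 : {y | [] <:+ W y ∧ Z y = z} = Z ⁻¹' {z} := by
    ext y
    simp
  have h1 : (fun y => (Z y, W y)) ⁻¹' {(z, w)} ⊆ {y | w <:+ W y ∧ Z y = z} := by
    intro y hy
    simp only [Set.mem_preimage, Set.mem_singleton_iff, Prod.mk.injEq] at hy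
    exact ⟨hy.2 ▸ List.suffix_rfl, hy.1⟩
  rw [condProb, suffixProb, suffixProb, h0]
  exact div_le_div_of_nonneg_right (measureReal_mono h1) measureReal_nonneg

/-- Words are read backwards, so the suffix `u` is the older part, already seen when the letter `a`
is predicted. Different `a` give disjoint events, as suffixes of equal length coincide. -/
theorem tsum_suffixProb_div_le [Countable A] (hW : MeasCells W) (hZ : MeasCells Z) (z : Γ)
    (u : List A) :
    ∑' a, ENNReal.ofReal (suffixProb ν W Z z (a :: u) / suffixProb ν W Z z u) ≤ 1 := by
  refine tsum_div_measureReal_le_one (fun a => ?_) (fun a y hy => ?_) fun a b hab => ?_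
  · exact (hW.preimage {w | a :: u <:+ w}).inter (hZ z)
  · exact ⟨(List.suffix_cons a u).trans hy.1, hy.2⟩
  · refine Set.disjoint_left.2 fun y hy hy' => hab ?_
    have := List.IsSuffix.eq_of_length
      (List.suffix_of_suffix_length_le hy.1 hy'.1 (by simp)) (by simp)
    exact (List.cons.inj this).1

end SuffixProb

/-- The visits in the past are eventually visible. -/
theorem tendsto_measure_pastVisit (hT : MeasurePreserving T μ μ) (hE : MeasurableSet E)
    (hsweep : SweepsOut μ T E) (M : ℕ) :
    Tendsto (fun L : ℕ => μ {x | (L : ℕ∞) < pastVisit T E M x}) atTop (𝓝 0) := by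
  have h := tendsto_measure_iInter_atTop (μ := μ)
    (s := fun L : ℕ => {x | (L : ℕ∞) < pastVisit T E M x})
    (fun L => ((measCells_pastVisit hE M).preimage {n | (L : ℕ∞) < n}).nullMeasurableSet)
    (fun i j hij x (hx : (j : ℕ∞) < _) =>
      show (i : ℕ∞) < _ from lt_of_le_of_lt (Nat.cast_le.2 hij) hx) ⟨0, measure_ne_top _ _⟩
  have h0 : μ (⋂ L : ℕ, {x | (L : ℕ∞) < pastVisit T E M x}) = 0 := by
    refine measure_mono_null (t := {x | ¬ ∀ n, returnTime T.symm E (T.symm^[n] x) ≠ ⊤}) ?_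
      (ae_iff.1 (ae_forall_returnTime_symm_ne_top hT hE hsweep))
    intro x hx hx'
    obtain ⟨n, hn⟩ := ENat.ne_top_iff_exists.1 (pastVisit_ne_top M x hx')
    have := Set.mem_iInter.1 hx n
    simp [← hn] at this
  rwa [h0] at h

/-- Predicting the letters of the process from the words of `E`. -/
theorem condEntropy_hatPartition_le (hT : MeasurePreserving T μ μ) (hE : MeasurableSet E)
    (hsweep : SweepsOut μ T E) (hQ : Measurable Q) (M L : ℕ) :
    condEntropy μ (hatPartition E Q)
      (fun x => itinerary T.symm (hatPartition E Q) L (T.symm x)) ≤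
    μ E * condEntropy (inducedMeasure μ E) (fun y : E => backWord T E Q y)
      (fun y => itinerary (inducedMap T.symm E) (fun y : E => backWord T E Q y) M
        (inducedMap T.symm E y)) +
    info ((Nat.card (κ × Bool) : ℝ)⁻¹) * μ {x | (L : ℕ∞) < pastVisit T E M x} := by
  classical
  have h0 := measure_ne_zero_of_sweepsOut hT hE hsweep
  have := isProbabilityMeasure_inducedMeasure hE h0
  set ν := inducedMeasure μ E with hν
  have hm := measCells_hatPartition (κ := κ) hE hQ
  have hmi := measCells_itinerary hm T.symm.measurable L
  have hmX : MeasCells (backWord T E Q) := measCells_backWord (T := T) hE hQ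
  set W : E → List (κ × Bool) := fun y => backWord T E Q y with hW
  have hmw : MeasCells W := hmX.comp_measurable measurable_subtype_coe
  have hS := measurePreserving_inducedMap T.symm (hT.symm T) hE
  set Z : E → List (List (κ × Bool)) := fun y =>
    itinerary (inducedMap T.symm E) W M (inducedMap T.symm E y) with hZ
  have hmz : MeasCells Z := (measCells_itinerary hmw hS.measurable M).comp_measurable hS.measurable
  set Zx : X → List (List (κ × Bool)) := fun x =>
    itinerary (backStep T E) (backWord T E Q) M (backStep T E x) with hZx
  have hmZx : MeasCells Zx := (measCells_itinerary hmX (measurable_backStep hE) M).comp_measurable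
    (measurable_backStep hE)
  have hZZ : ∀ y : E, Z y = Zx y := fun y => itinerary_inducedMap M _
  set r : List (List (κ × Bool)) → List (κ × Bool) → κ × Bool → ℝ := fun z u a =>
    suffixProb ν W Z z (a :: u) / suffixProb ν W Z z u with hr
  set c : ℝ := (Nat.card (κ × Bool) : ℝ)⁻¹ with hc
  set past : X → List (κ × Bool) := fun x => itinerary T.symm (hatPartition E Q) L (T.symm x)
    with hpast
  -- If the window shows the `M` preceding words, use the law of the current word given them and its
  -- part already read; otherwise guess uniformly. A predictor must be a function of the window,
  -- hence the chosen representative, which is immaterial by `hcongr`.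
  set q : List (κ × Bool) → κ × Bool → ℝ := fun l a =>
    if h : ∃ x, past x = l ∧ pastVisit T E M x ≤ L then
      r (Zx h.choose) (backWord T E Q h.choose).tail a else c with hq
  have hq0 : ∀ l a, 0 ≤ q l a := by
    intro l a
    simp only [hq]
    split_ifs
    · exact div_nonneg (suffixProb_nonneg _ _) (suffixProb_nonneg _ _)
    · positivity
  have hqs : ∀ l, ∑' a, ENNReal.ofReal (q l a) ≤ 1 := by
    intro l
    by_cases h : ∃ x, past x = l ∧ pastVisit T E M x ≤ L
    · simp only [hq, dif_pos h]
      exact tsum_suffixProb_div_le hmw hmz _ _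
    · simp only [hq, dif_neg h]
      exact tsum_uniform_le_one κ
  have hcongr : ∀ x x', past x = past x' → pastVisit T E M x ≤ L →
      pastVisit T E M x' = pastVisit T E M x ∧
      (backWord T E Q x').tail = (backWord T E Q x).tail ∧ Zx x' = Zx x := by
    intro x x' h hτ
    refine past_congr M L x x' hτ fun j h1 h2 => ?_
    have := (itinerary_eq_iff _ _).1 h (j - 1) (by omega)
    rwa [← Function.iterate_succ_apply, ← Function.iterate_succ_apply,
      show (j - 1).succ = j by omega] at this
  have hqx : ∀ x, pastVisit T E M x ≤ L → q (past x) (hatPartition E Q x) =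
      r (Zx x) (backWord T E Q x).tail (hatPartition E Q x) := by
    intro x hx
    have h : ∃ x', past x' = past x ∧ pastVisit T E M x' ≤ L := ⟨x, rfl, hx⟩
    simp only [hq, dif_pos h]
    obtain ⟨-, e1, e2⟩ := hcongr x h.choose h.choose_spec.1.symm hx
    rw [e1, e2]
  -- Visibility is itself a property of the window: no point with this past has its words visible.
  have hqx' : ∀ x, (L : ℕ∞) < pastVisit T E M x → q (past x) (hatPartition E Q x) = c := by
    intro x hx
    simp only [hq]
    rw [dif_neg]
    rintro ⟨x', h1, h2⟩
    rw [(hcongr x' x h1 h2).1] at hx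
    exact hx.not_ge h2
  set cost : X → ℝ≥0∞ := fun x => info (suffixProb ν W Z (Zx x) (backWord T E Q x) /
    suffixProb ν W Z (Zx x) (backWord T E Q x).tail) with hcost
  have hmcost : Measurable cost := (hmZx.prodMk hmX).measurable_comp fun p =>
    info (suffixProb ν W Z p.1 p.2 / suffixProb ν W Z p.1 p.2.tail)
  have hmvis : MeasurableSet {x | (L : ℕ∞) < pastVisit T E M x} :=
    (measCells_pastVisit hE M).preimage {n | (L : ℕ∞) < n}
  have hfin : staticEntropy μ past ≠ ∞ := by
    rw [hpast, staticEntropy_comp_measurePreserving hmi (hT.symm T)]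
    simp only [funext (itinerary_eq_ofFn T.symm (hatPartition E Q) L)]
    rw [staticEntropy_comp_injective (List.ofFn_injective (n := L))]
    refine staticEntropy_join_ne_top hm (hT.symm T) ?_ L
    have := Fintype.ofFinite κ
    rw [staticEntropy, tsum_fintype]
    exact ENNReal.sum_ne_top.2 fun _ _ => ENNReal.ofReal_ne_top
  have h1 := condEntropy_le hm (hmi.comp_measurable T.symm.measurable) hfin hq0 hqs
  have h2 : ∫⁻ x, info (q (past x) (hatPartition E Q x)) ∂μ ≤
      ∫⁻ x, cost x + {x | (L : ℕ∞) < pastVisit T E M x}.indicator (fun _ => info c) x ∂μ := by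
    refine lintegral_mono fun x => ?_
    rcases le_or_gt (pastVisit T E M x) L with hx | hx
    · refine le_trans (le_of_eq ?_) le_self_add
      have hne : returnTime T.symm E x ≠ ⊤ := ne_top_of_le_ne_top (ENat.natCast_ne_top _)
        ((returnTime_le_pastVisit M _).trans hx)
      simp only [hcost]
      rw [hqx x hx]
      conv_rhs => rw [backWord_eq_cons hne, List.tail_cons]
    · rw [hqx' x hx, Set.indicator_of_mem (by exact hx)]
      exact le_add_self
  have h3 : ∫⁻ x, cost x ∂μ ≤ μ E * condEntropy ν W Z := by
    have ht := lintegral_tower T hT hE hsweep hmcost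
    have : ∫⁻ x, cost x ∂μ = μ E * ((μ E)⁻¹ * ∫⁻ x, cost x ∂μ) := by
      rw [← mul_assoc, ENNReal.mul_inv_cancel h0 (measure_ne_top _ _), one_mul]
    rw [this, ← ht]
    -- In the column below `y` the words before the current one do not change and the part already
    -- read runs through the suffixes of `W y`, so the costs telescope.
    refine mul_le_mul_right (lintegral_mono fun y => ?_) _
    refine le_trans (le_of_eq ?_) ((sum_info_div_le (f := suffixProb ν W Z (Z y))
      (suffixProb_nonneg _) (suffixProb_cons_le _) (W y)).trans (info_suffixProb_le _ _))
    rw [show (W y).length = _ from length_backWord _]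
    refine Finset.sum_congr rfl fun j hj => ?_
    obtain ⟨e1, e2⟩ := backWord_iterate (Q := Q) (Finset.mem_range.1 hj)
    simp only [hcost]
    rw [e1, List.tail_drop, hZZ, hZx]
    simp only [e2, hW]
  refine h1.trans (h2.trans ?_)
  rw [lintegral_add_left hmcost, lintegral_indicator_const hmvis]
  exact add_le_add_left h3 _

end Comparison

/-! ### The entropy formula -/

section EntropyFormula

variable {X κ : Type*} [MeasurableSpace X] {μ : Measure X} [IsProbabilityMeasure μ] {T : X ≃ᵐ X}
  {E : Set X} [Finite κ] [MeasurableSpace κ] [DiscreteMeasurableSpace κ] {Q : X → κ}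

/-- Both rates are rewritten for the inverse maps, so that the limits are conditional entropies
given the past, and the two one-sided comparisons are passed to the limit. -/
theorem exists_tendsto_entropyRate_adapted (hT : MeasurePreserving T μ μ) (hE : MeasurableSet E)
    (hsweep : SweepsOut μ T E) (hQ : Measurable Q) :
    ∃ hE' h : ℝ≥0∞,
      Tendsto (entropyRate (inducedMeasure μ E) (inducedMap T E) (adapted T E Q)) atTop (𝓝 hE') ∧
      Tendsto (entropyRate μ T (hatPartition E Q)) atTop (𝓝 h) ∧ h < ∞ ∧ μ E * hE' = h := by
  have h0 := measure_ne_zero_of_sweepsOut hT hE hsweep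
  have := isProbabilityMeasure_inducedMeasure hE h0
  have : Nonempty X := nonempty_of_isProbabilityMeasure μ
  have : Nonempty κ := this.map Q
  have hm := measCells_hatPartition (κ := κ) hE hQ
  have hmw : MeasCells fun y : E => backWord T E Q y :=
    (measCells_backWord (T := T) hE hQ).comp_measurable measurable_subtype_coe
  have hS := measurePreserving_inducedMap T.symm (hT.symm T) hE
  have hTE := measurePreserving_inducedMap T hT hE
  have hfin : staticEntropy μ (hatPartition E Q) ≠ ∞ := by
    have := Fintype.ofFinite κ
    rw [staticEntropy, tsum_fintype]
    exact ENNReal.sum_ne_top.2 fun _ _ => ENNReal.ofReal_ne_top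
  obtain ⟨h, hh, l1, l2⟩ := exists_tendsto_entropyRate hm (hT.symm T) hfin
  obtain ⟨hE', -, l3, l4⟩ := exists_tendsto_entropyRate hmw hS
    (staticEntropy_adapted_lt_top hT hE hsweep hQ).ne
  have e1 : entropyRate μ T (hatPartition E Q) = entropyRate μ T.symm (hatPartition E Q) := by
    funext n
    rw [entropyRate, entropyRate, staticEntropy_join_inverse hm T.symm.measurable hT
      (ae_of_all _ T.symm_apply_apply)]
  have e2 : entropyRate (inducedMeasure μ E) (inducedMap T E) (adapted T E Q) =
      entropyRate (inducedMeasure μ E) (inducedMap T.symm E) (fun y : E => backWord T E Q y) := by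
    funext n
    rw [entropyRate, entropyRate]
    refine congrArg (· / (n : ℝ≥0∞)) (staticEntropy_join_inverse hmw hS.measurable hTE ?_ n)
    exact (ae_inducedMeasure hE (ae_mem_imp_returnTime_ne_top hT hE)).mono fun y hy =>
      (inducedMap_symm_inducedMap T hy).1
  refine ⟨hE', h, e2 ▸ l3, e1 ▸ l1, hh.lt_top, le_antisymm ?_ ?_⟩
  · refine le_of_tendsto_of_tendsto' (ENNReal.Tendsto.const_mul l4 (Or.inr (measure_ne_top _ _)))
      l2 fun N => ?_
    rw [← condEntropy_itinerary, ← condEntropy_itinerary]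
    exact measure_mul_condEntropy_le hT hE hsweep hQ N
  · refine ge_of_tendsto' (ENNReal.Tendsto.const_mul l4 (Or.inr (measure_ne_top _ _)))
      fun M => ?_
    -- With `M` fixed, `L → ∞` removes the cost of the uniform guesses; only then does `M` grow.
    have l5 := ENNReal.Tendsto.const_mul (a := info ((Nat.card (κ × Bool) : ℝ)⁻¹))
      (tendsto_measure_pastVisit hT hE hsweep M) (Or.inr (info_uniform_ne_top κ))
    have l6 := (tendsto_const_nhds (x := μ E * condEntropy (inducedMeasure μ E)
      (fun y : E => backWord T E Q y) (fun y => join (inducedMap T.symm E)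
        (fun y : E => backWord T E Q y) M (inducedMap T.symm E y)))).add l5
    rw [mul_zero, add_zero] at l6
    refine le_of_tendsto_of_tendsto' l2 l6 fun L => ?_
    rw [← condEntropy_itinerary, ← condEntropy_itinerary]
    exact condEntropy_hatPartition_le hT hE hsweep hQ M L

end EntropyFormula

/-! ### Processes and the shift -/

section Names

variable {X Λ : Type*} [MeasurableSpace X] (T : X ≃ᵐ X)

theorem zpow_apply_eq_iterate (i : ℤ) :
    (∃ n : ℕ, ⇑((T.toEquiv : Equiv.Perm X) ^ i) = T^[n]) ∨
      ∃ n : ℕ, ⇑((T.toEquiv : Equiv.Perm X) ^ i) = T.symm^[n] := by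
  cases i with
  | ofNat n =>
    refine Or.inl ⟨n, ?_⟩
    rw [Int.ofNat_eq_natCast, zpow_natCast, ← Equiv.Perm.iterate_eq_pow]
    rfl
  | negSucc n =>
    refine Or.inr ⟨n + 1, ?_⟩
    rw [zpow_negSucc, ← inv_pow, ← Equiv.Perm.iterate_eq_pow]
    rfl

theorem measurable_zpow (i : ℤ) : Measurable ((T.toEquiv : Equiv.Perm X) ^ i) := by
  rcases zpow_apply_eq_iterate T i with ⟨n, h⟩ | ⟨n, h⟩
  · rw [h]
    exact T.measurable.iterate n
  · rw [h]
    exact T.symm.measurable.iterate n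

theorem measurePreserving_zpow {μ : Measure X} (hT : MeasurePreserving T μ μ) (i : ℤ) :
    MeasurePreserving ((T.toEquiv : Equiv.Perm X) ^ i) μ μ := by
  rcases zpow_apply_eq_iterate T i with ⟨n, h⟩ | ⟨n, h⟩
  · rw [h]
    exact hT.iterate n
  · rw [h]
    exact (hT.symm T).iterate n

theorem zpow_apply_map (i : ℤ) (x : X) :
    ((T.toEquiv : Equiv.Perm X) ^ i) (T x) = ((T.toEquiv : Equiv.Perm X) ^ (i + 1)) x := by
  rw [zpow_add_one]
  rfl

theorem process_map (P : X → Λ) (x : X) : process T P (T x) = shift (process T P x) := by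
  funext i
  exact congrArg P (zpow_apply_map T i x)

theorem process_iterate (P : X → Λ) (n : ℕ) (x : X) : process T P x n = P (T^[n] x) := by
  rw [process, zpow_natCast, ← Equiv.Perm.iterate_eq_pow]
  rfl

theorem measurable_process [MeasurableSpace Λ] {P : X → Λ} (hP : Measurable P) :
    Measurable (process T P) :=
  measurable_pi_lambda _ fun i => hP.comp (measurable_zpow T i)

/-- The left shift as an automorphism of the space of two-sided sequences. -/
def shiftEquiv (Λ : Type*) [MeasurableSpace Λ] : (ℤ → Λ) ≃ᵐ (ℤ → Λ) where
  toFun := shift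
  invFun := fun a i => a (i - 1)
  left_inv := fun a => by simp [shift]
  right_inv := fun a => funext fun i => congrArg a (by ring)
  measurable_toFun := measurable_pi_lambda _ fun i => measurable_pi_apply (i + 1)
  measurable_invFun := measurable_pi_lambda _ fun i => measurable_pi_apply (i - 1)

variable [MeasurableSpace Λ]

theorem shiftEquiv_apply (a : ℤ → Λ) : shiftEquiv Λ a = shift a := rfl

theorem shiftEquiv_iterate (n : ℕ) (a : ℤ → Λ) (i : ℤ) :
    (shiftEquiv Λ)^[n] a i = a (i + n) := by
  induction n generalizing a with
  | zero => simp
  | succ n ih =>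
    rw [Function.iterate_succ_apply, ih, shiftEquiv_apply, shift]
    congr 1
    push_cast
    ring

theorem shiftEquiv_symm_iterate (n : ℕ) (a : ℤ → Λ) (i : ℤ) :
    (shiftEquiv Λ).symm^[n] a i = a (i - n) := by
  induction n generalizing a with
  | zero => simp
  | succ n ih =>
    rw [Function.iterate_succ_apply, ih]
    change a (i - n - 1) = _
    congr 1
    push_cast
    ring

variable {T} in
/-- The process map intertwines the powers of `T` and of the shift. -/
theorem process_zpow_eq (P : X → Λ) (i : ℤ) (x : X) :
    process T P (((T.toEquiv : Equiv.Perm X) ^ i) x) =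
      (((shiftEquiv Λ).toEquiv : Equiv.Perm (ℤ → Λ)) ^ i) (process T P x) := by
  induction i generalizing x with
  | zero => rfl
  | succ i ih =>
    rw [← zpow_apply_map, ih, process_map, ← shiftEquiv_apply, zpow_apply_map]
  | pred i ih =>
    have h := ih (T.symm x)
    have h1 : process T P (T.symm x) = (shiftEquiv Λ).symm (process T P x) := by
      rw [eq_comm, MeasurableEquiv.symm_apply_eq, shiftEquiv_apply, ← process_map,
        T.apply_symm_apply]
    rw [h1] at h
    rw [zpow_sub_one, zpow_sub_one]
    exact h

end Names

/-! ### Stationary codes between processes -/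

section Codes

variable {X A B : Type*} [MeasurableSpace X] {μ : Measure X} {T : X ≃ᵐ X}
  [MeasurableSpace A] [MeasurableSpace B]

/-- A stationary code given by its zeroth coordinate. -/
theorem isFinitaryCode_process {P : X → A} {R : X → B} (hP : Measurable P)
    {c : (ℤ → A) → B} (hc : Measurable c) (hT : MeasurePreserving T μ μ)
    (hR : ∀ᵐ x ∂μ, c (process T P x) = R x) {G : Set (ℤ → A)} (hG : MeasurableSet G)
    (hμG : ∀ᵐ x ∂μ, process T P x ∈ G)
    (hfin : ∀ a ∈ G, ∃ n : ℕ, ∀ b : ℤ → A, (∀ i : ℤ, |i| ≤ n → b i = a i) → c b = c a) :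
    IsFinitaryCode (processLaw μ T P) (processLaw μ T R) (process (shiftEquiv A) c) ∧
      ∀ᵐ x ∂μ, process (shiftEquiv A) c (process T P x) = process T R x := by
  have hae : ∀ᵐ x ∂μ, process (shiftEquiv A) c (process T P x) = process T R x := by
    have := ae_all_iff.2 fun i : ℤ => (measurePreserving_zpow T hT i).quasiMeasurePreserving.ae hR
    filter_upwards [this] with x hx
    funext i
    rw [process, ← process_zpow_eq]
    exact hx i
  refine ⟨⟨⟨measurable_process _ hc, ?_⟩, ?_, ?_⟩, hae⟩
  · rw [processLaw, Measure.map_map (measurable_process _ hc) (measurable_process _ hP)]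
    exact Measure.map_congr hae
  · exact ae_of_all _ fun a => process_map (shiftEquiv A) c a
  · refine ((ae_map_iff (measurable_process T hP).aemeasurable hG).2 hμG).mono fun a ha => ?_
    obtain ⟨n, hn⟩ := hfin a ha
    exact ⟨n, ae_of_all _ fun b hb => hn b hb⟩

/-- The law is an image of `μ`, so it suffices to check names of points, once the set of fixed
sequences is known to be measurable; this is where countability of the alphabet enters. -/
theorem ae_processLaw_eq [Countable A] [MeasurableSingletonClass A] {P : X → A}
    (hP : Measurable P) {f : (ℤ → A) → (ℤ → A)} (hf : Measurable f)
    (h : ∀ᵐ x ∂μ, f (process T P x) = process T P x) : ∀ᵐ a ∂(processLaw μ T P), f a = a := by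
  refine (ae_map_iff (measurable_process T hP).aemeasurable ?_).2 h
  have e : {a | f a = a} = ⋂ i, {a | f a i = a i} := by
    ext a
    simp [funext_iff]
  rw [e]
  exact MeasurableSet.iInter fun i =>
    measurableSet_eq_fun ((measurable_pi_apply i).comp hf) (measurable_pi_apply i)

end Codes

/-! ### The finitary isomorphism -/

theorem returnTime_map {X Y : Type*} {T : X → X} {S : Y → Y} {E : Set X} {F : Set Y} {f : X → Y}
    (hf : Function.Semiconj f T S) (hE : ∀ x, f x ∈ F ↔ x ∈ E) (x : X) :
    returnTime S F (f x) = returnTime T E x := by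
  have h : ∀ n, S^[n] (f x) ∈ F ↔ T^[n] x ∈ E := fun n => by
    rw [← (hf.iterate_right n) x, hE]
  rcases eq_or_ne (returnTime T E x) ⊤ with hx | hx
  · rw [hx]
    by_contra hy
    obtain ⟨n, h1, h2⟩ := returnTime_ne_top_iff.1 hy
    exact returnTime_ne_top_iff.2 ⟨n, h1, (h n).1 h2⟩ hx
  · rw [← ENat.natCast_toNat hx]
    exact returnTime_congr (ENat.natCast_toNat hx).symm fun j _ _ => (h j).symm

instance (κ : Type*) : DiscreteMeasurableSpace (ExtBlock κ) := ⟨fun _ => trivial⟩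

section Isomorphism

variable {X κ : Type*} [MeasurableSpace X] {T : X ≃ᵐ X} {E : Set X} {Q : X → κ}

/-- The symbol that names the block `w`. -/
def ExtBlock.ofList (w : List (κ × Bool)) : ExtBlock κ := some w

/-- The symbol that names the complement of `E`. -/
def ExtBlock.outside : ExtBlock κ := none

theorem adaptedExt_of_mem {x : X} (hx : x ∈ E) :
    adaptedExt T E Q x = ExtBlock.ofList (backWord T E Q x) := dif_pos hx

theorem adaptedExt_of_notMem {x : X} (hx : x ∉ E) : adaptedExt T E Q x = ExtBlock.outside := dif_neg hx

theorem adaptedExt_ne_outside_iff {x : X} : adaptedExt T E Q x ≠ ExtBlock.outside ↔ x ∈ E := by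
  by_cases hx : x ∈ E
  · rw [adaptedExt_of_mem hx]
    exact iff_of_true (Option.some_ne_none _) hx
  · rw [adaptedExt_of_notMem hx]
    exact iff_of_false (fun h => h rfl) hx

theorem measurable_adaptedExt [Countable κ] [MeasurableSpace κ] [DiscreteMeasurableSpace κ]
    (hE : MeasurableSet E) (hQ : Measurable Q) : Measurable (adaptedExt T E Q) := by
  classical
  have h : adaptedExt T E Q = fun x =>
      if x ∈ E then ExtBlock.ofList (backWord T E Q x) else ExtBlock.outside := by
    funext x
    by_cases hx : x ∈ E
    · rw [if_pos hx, adaptedExt_of_mem hx]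
    · rw [if_neg hx, adaptedExt_of_notMem hx]
  rw [h]
  exact Measurable.ite hE ((measCells_backWord hE hQ).measurable_comp _) measurable_const

theorem measurable_hatPartition [Countable κ] [MeasurableSpace κ] [DiscreteMeasurableSpace κ]
    (hE : MeasurableSet E) (hQ : Measurable Q) : Measurable (hatPartition E Q) :=
  (measCells_hatPartition hE hQ).measurable_comp id

/-- The adapted partition is natural under factor maps. -/
theorem adaptedExt_map {Y : Type*} [MeasurableSpace Y] {S : Y ≃ᵐ Y} {F : Set Y} {R : Y → κ}
    {f : X → Y} (hf : ∀ x, f (T.symm x) = S.symm (f x)) (hE : ∀ x, f x ∈ F ↔ x ∈ E)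
    (hR : ∀ x, R (f x) = Q x) (x : X) : adaptedExt S F R (f x) = adaptedExt T E Q x := by
  have hs : Function.Semiconj f T.symm S.symm := hf
  have hhat : ∀ x, hatPartition F R (f x) = hatPartition E Q x := fun x => by
    refine Prod.ext (hR x) ?_
    rw [Bool.eq_iff_iff, hatPartition_snd, hatPartition_snd, hE]
  by_cases hx : x ∈ E
  · rw [adaptedExt_of_mem hx, adaptedExt_of_mem ((hE x).2 hx)]
    refine congrArg ExtBlock.ofList ?_
    rw [backWord, backWord, returnTime_map hs hE, itinerary, itinerary]
    refine List.map_congr_left fun j _ => ?_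
    rw [← (hs.iterate_right j) x, hhat]
  · rw [adaptedExt_of_notMem hx, adaptedExt_of_notMem fun h => hx ((hE x).1 h)]

theorem process_symm {Λ : Type*} [MeasurableSpace Λ] (P : X → Λ) (x : X) :
    process T P (T.symm x) = (shiftEquiv Λ).symm (process T P x) := by
  rw [eq_comm, MeasurableEquiv.symm_apply_eq, shiftEquiv_apply, ← process_map,
    T.apply_symm_apply]

/-- The sequences of letters whose zeroth letter is starred. -/
def starred (κ : Type*) : Set (ℤ → κ × Bool) := {a | (a 0).2 = true}

/-- The zeroth coordinate of the code from letters to blocks. -/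
def encode (κ : Type*) [MeasurableSpace κ] : (ℤ → κ × Bool) → ExtBlock κ :=
  adaptedExt (shiftEquiv (κ × Bool)) (starred κ) fun a => (a 0).1

/-- The letter number `k` of a block. -/
def letterAt (d : κ × Bool) (k : ℕ) : ExtBlock κ → κ × Bool
  | none => d
  | some w => List.getD w k d

/-- The sequences of blocks whose zeroth symbol is not `0`. -/
def blocked (κ : Type*) : Set (ℤ → ExtBlock κ) := {z | z 0 ≠ ExtBlock.outside}

/-- The time of the next block, counted from `1`. -/
def nextBlock (z : ℤ → ExtBlock κ) : ℕ∞ :=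
  returnTime (shiftEquiv (ExtBlock κ)) (blocked κ) ((shiftEquiv (ExtBlock κ)).symm z)

/-- The zeroth coordinate of the code from blocks to letters: it reads the letter off the next
block. -/
def decode (d : κ × Bool) (z : ℤ → ExtBlock κ) : κ × Bool :=
  letterAt d ((nextBlock z).toNat - 1) (z ((nextBlock z).toNat - 1 : ℕ))

theorem measurableSet_blocked : MeasurableSet (blocked κ) :=
  measurable_pi_apply (X := fun _ : ℤ => ExtBlock κ) 0
    (MeasurableSet.of_discrete (s := {b : ExtBlock κ | b ≠ ExtBlock.outside}))

theorem measCells_nextBlock : MeasCells (nextBlock (κ := κ)) :=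
  (measCells_returnTime (shiftEquiv (ExtBlock κ)).measurable measurableSet_blocked).comp_measurable
    (shiftEquiv (ExtBlock κ)).symm.measurable

theorem shiftEquiv_iterate_symm_mem_blocked {j : ℕ} (hj : 1 ≤ j) (z : ℤ → ExtBlock κ) :
    (shiftEquiv (ExtBlock κ))^[j] ((shiftEquiv (ExtBlock κ)).symm z) ∈ blocked κ ↔
      z (j - 1 : ℕ) ≠ ExtBlock.outside := by
  obtain ⟨k, rfl⟩ := Nat.exists_eq_add_of_le' hj
  rw [Function.iterate_succ_apply, MeasurableEquiv.apply_symm_apply]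
  change (shiftEquiv (ExtBlock κ))^[k] z 0 ≠ ExtBlock.outside ↔ _
  rw [shiftEquiv_iterate, zero_add, Nat.add_sub_cancel]

theorem shiftEquiv_symm_iterate_mem_starred [MeasurableSpace κ] (j : ℕ) (a : ℤ → κ × Bool) :
    (shiftEquiv (κ × Bool)).symm^[j] a ∈ starred κ ↔ (a (-j)).2 = true := by
  change ((shiftEquiv (κ × Bool)).symm^[j] a 0).2 = true ↔ _
  rw [shiftEquiv_symm_iterate, zero_sub]

theorem hatPartition_starred (a : ℤ → κ × Bool) :
    hatPartition (starred κ) (fun a => (a 0).1) a = a 0 := by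
  refine Prod.ext rfl ?_
  rw [Bool.eq_iff_iff, hatPartition_snd]
  rfl

/-- `encode` is the adapted partition of the shift itself, and naming points is a factor map onto
the shift. -/
theorem encode_process [MeasurableSpace κ] (x : X) :
    encode κ (process T (hatPartition E Q) x) = adaptedExt T E Q x := by
  refine adaptedExt_map (process_symm _) (fun x => ?_) (fun x => rfl) x
  exact hatPartition_snd x

/-- Let `k ≥ 0` be the first time in `E`. There is no visit at times `0, …, k - 1`, so the word at
`T^k x` is longer than `k` and its entry `k`, counted backwards from `0`, is the letter of `x`. -/
theorem decode_process (d : κ × Bool) {x : X} (h1 : ∃ n : ℕ, T^[n] x ∈ E)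
    (h2 : ∀ n : ℕ, T^[n] x ∈ E → returnTime T.symm E (T^[n] x) ≠ ⊤) :
    decode d (process T (adaptedExt T E Q) x) = hatPartition E Q x := by
  classical
  set k := Nat.find h1
  have hk : T^[k] x ∈ E := Nat.find_spec h1
  have hmin : ∀ i < k, T^[i] x ∉ E := fun i hi => Nat.find_min h1 hi
  have hn : nextBlock (process T (adaptedExt T E Q) x) = (k + 1 : ℕ) := by
    refine returnTime_eq_coe_iff.2 ⟨⟨by omega, ?_⟩, fun m hm hm' => ?_⟩
    · rw [shiftEquiv_iterate_symm_mem_blocked (by omega), process_iterate,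
        adaptedExt_ne_outside_iff]
      exact hk
    · obtain ⟨h1m, hm2⟩ := hm'
      rw [shiftEquiv_iterate_symm_mem_blocked h1m, process_iterate, adaptedExt_ne_outside_iff] at hm2
      exact hmin (m - 1) (by omega) hm2
  have hlt : k < (returnTime T.symm E (T^[k] x)).toNat := by
    have : (k : ℕ∞) < returnTime T.symm E (T^[k] x) := by
      rw [lt_returnTime_iff]
      intro i hi1 hi2
      rw [symm_iterate_iterate T hi2]
      exact hmin _ (by omega)
    rw [← ENat.natCast_toNat (h2 k hk)] at this
    exact_mod_cast this
  rw [decode, hn, ENat.toNat_natCast, Nat.add_sub_cancel, process_iterate, adaptedExt_of_mem hk]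
  change List.getD (backWord T E Q (T^[k] x)) k d = _
  rw [List.getD_eq_getElem _ _ (by rwa [length_backWord])]
  simp only [backWord, itinerary, List.getElem_map, List.getElem_range]
  rw [symm_iterate_iterate T le_rfl, Nat.sub_self]
  rfl

/-- Decoding only anticipates: coordinates from `0` up to the next block determine both its position
and its content. -/
theorem exists_window_decode (d : κ × Bool) {z : ℤ → ExtBlock κ} (hz : nextBlock z ≠ ⊤) :
    ∃ n : ℕ, ∀ y : ℤ → ExtBlock κ, (∀ i : ℤ, |i| ≤ n → y i = z i) → decode d y = decode d z := by
  obtain ⟨n, hn⟩ := ENat.ne_top_iff_exists.1 hz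
  refine ⟨n, fun y hy => ?_⟩
  have hy' : ∀ j : ℕ, j ≤ n → y j = z j := fun j hj => hy j (by
    rw [abs_of_nonneg (by positivity)]
    exact_mod_cast hj)
  have : nextBlock y = n := returnTime_congr hn.symm fun j h1 h2 => by
    rw [shiftEquiv_iterate_symm_mem_blocked h1, shiftEquiv_iterate_symm_mem_blocked h1,
      hy' _ (by omega)]
  rw [decode, decode, this, ← hn, ENat.toNat_natCast, hy' _ (by omega)]

/-- Encoding only remembers: a starred letter needs the coordinates back to the previous star, an
unstarred one only itself. -/
theorem exists_window_encode [MeasurableSpace κ] {a : ℤ → κ × Bool}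
    (ha : a ∈ starred κ → returnTime (shiftEquiv (κ × Bool)).symm (starred κ) a ≠ ⊤) :
    ∃ n : ℕ, ∀ b : ℤ → κ × Bool, (∀ i : ℤ, |i| ≤ n → b i = a i) → encode κ b = encode κ a := by
  by_cases h : a ∈ starred κ
  · obtain ⟨n, hn⟩ := ENat.ne_top_iff_exists.1 (ha h)
    refine ⟨n, fun b hb => ?_⟩
    have hb' : ∀ j : ℕ, j ≤ n → b (-j) = a (-j) := fun j hj => hb _ (by
      rw [abs_neg, abs_of_nonneg (by positivity)]
      exact_mod_cast hj)
    have hb0 : b 0 = a 0 := by simpa using hb' 0 (Nat.zero_le n)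
    have hbs : b ∈ starred κ := by
      change (b 0).2 = true
      rw [hb0]
      exact h
    have hr : returnTime (shiftEquiv (κ × Bool)).symm (starred κ) b = n :=
      returnTime_congr hn.symm fun j _ h2 => by
        rw [shiftEquiv_symm_iterate_mem_starred, shiftEquiv_symm_iterate_mem_starred, hb' j h2]
    rw [encode, adaptedExt_of_mem h, adaptedExt_of_mem hbs]
    refine congrArg ExtBlock.ofList ?_
    rw [backWord, backWord, hr, ← hn, ENat.toNat_natCast, itinerary_eq_iff]
    intro j hj
    rw [hatPartition_starred, hatPartition_starred, shiftEquiv_symm_iterate,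
      shiftEquiv_symm_iterate, zero_sub, hb' j hj.le]
  · refine ⟨0, fun b hb => ?_⟩
    have hb0 : b 0 = a 0 := hb 0 (by simp)
    have hbs : b ∉ starred κ := by
      change ¬ (b 0).2 = true
      rw [hb0]
      exact h
    rw [encode, adaptedExt_of_notMem h, adaptedExt_of_notMem hbs]

theorem measurable_decode [MeasurableSpace κ] (d : κ × Bool) : Measurable (decode d) := by
  have h1 : Measurable fun p : ℕ × (ℤ → ExtBlock κ) => letterAt d (p.1 - 1) (p.2 (p.1 - 1 : ℕ)) :=
    measurable_from_prod_countable_right fun n =>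
      (Measurable.of_discrete (f := letterAt d (n - 1))).comp (measurable_pi_apply ((n - 1 : ℕ) : ℤ))
  exact h1.comp ((measCells_nextBlock.measurable_comp ENat.toNat).prodMk measurable_id)

variable [Countable κ] [MeasurableSpace κ] [DiscreteMeasurableSpace κ]

theorem measurableSet_starred : MeasurableSet (starred κ) :=
  measurable_pi_apply (X := fun _ : ℤ => κ × Bool) 0
    (MeasurableSet.of_discrete (s := {p : κ × Bool | p.2 = true}))

theorem measurable_encode : Measurable (encode κ) :=
  measurable_adaptedExt measurableSet_starred (measurable_pi_apply (0 : ℤ)).fst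

theorem finitarilyIsomorphic_adaptedExt {μ : Measure X} [IsProbabilityMeasure μ]
    (hT : MeasurePreserving T μ μ) (hE : MeasurableSet E) (hsweep : SweepsOut μ T E)
    (hQ : Measurable Q) :
    FinitarilyIsomorphic (processLaw μ T (adaptedExt T E Q))
      (processLaw μ T (hatPartition E Q)) := by
  have : Nonempty X := nonempty_of_isProbabilityMeasure μ
  obtain ⟨x₀⟩ := this
  have hmP : Measurable (adaptedExt T E Q) := measurable_adaptedExt hE hQ
  have hmQ : Measurable (hatPartition E Q) := measurable_hatPartition hE hQ
  have hback := ae_mem_imp_returnTime_ne_top (hT.symm T) hE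
  have hback' : ∀ᵐ x ∂μ, ∀ n : ℕ, T^[n] x ∈ E → returnTime T.symm E (T^[n] x) ≠ ⊤ :=
    ae_all_iff.2 fun n => (hT.iterate n).quasiMeasurePreserving.ae hback
  have hfwd := ae_exists_iterate_mem hT.measurable hE hsweep
  -- An arbitrary default letter, returned only on a null set of block sequences.
  set d := hatPartition E Q x₀
  obtain ⟨hφ, hφe⟩ := isFinitaryCode_process (T := T) hmP (measurable_decode d) hT
    (R := hatPartition E Q) (by
      filter_upwards [hback', hfwd] with x h2 h1
      exact decode_process d h1 h2)
    (G := {z | nextBlock z ≠ ⊤}) (measCells_nextBlock.preimage {n | n ≠ ⊤})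
    (by
      filter_upwards [hfwd] with x hx
      obtain ⟨n, hn⟩ := hx
      refine returnTime_ne_top_iff.2 ⟨n + 1, by omega, ?_⟩
      rwa [shiftEquiv_iterate_symm_mem_blocked (by omega), process_iterate,
        adaptedExt_ne_outside_iff])
    fun z hz => exists_window_decode d hz
  obtain ⟨hψ, hψe⟩ := isFinitaryCode_process (T := T) hmQ (measurable_encode (κ := κ)) hT
    (R := adaptedExt T E Q) (ae_of_all _ encode_process)
    (G := {a | a ∈ starred κ → returnTime (shiftEquiv (κ × Bool)).symm (starred κ) a ≠ ⊤})
    (by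
      have h1 := (measCells_returnTime (shiftEquiv (κ × Bool)).symm.measurable
        (measurableSet_starred (κ := κ))).preimage {n | n ≠ ⊤}
      convert (measurableSet_starred (κ := κ)).compl.union h1 using 1
      ext a
      exact imp_iff_not_or)
    (by
      filter_upwards [hback] with x hx hxE
      have hs : Function.Semiconj (process T (hatPartition E Q)) T.symm
        (shiftEquiv (κ × Bool)).symm := process_symm _
      rw [returnTime_map hs (E := E) fun x => hatPartition_snd x]
      exact hx ((hatPartition_snd x).1 hxE))
    fun a ha => exists_window_encode ha
  refine ⟨_, _, hφ, hψ, ?_, ?_⟩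
  · refine ae_processLaw_eq hmP
      (hψ.measurePreserving.measurable.comp hφ.measurePreserving.measurable) ?_
    filter_upwards [hφe, hψe] with x h1 h2
    rw [h1, h2]
  · refine ae_processLaw_eq hmQ
      (hφ.measurePreserving.measurable.comp hψ.measurePreserving.measurable) ?_
    filter_upwards [hφe, hψe] with x h1 h2
    rw [h2, h1]

end Isomorphism

/-! ### The adapted partition as a partition -/

section Partition

variable {X κ : Type*} [MeasurableSpace X] {T : X ≃ᵐ X} {E : Set X} {Q : X → κ}

/-- The label given by the word `w`. -/
def Block.ofList (w : List (κ × Bool)) : Block κ := w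

theorem measurable_adapted [Countable κ] [MeasurableSpace κ] [DiscreteMeasurableSpace κ]
    (hE : MeasurableSet E) (hQ : Measurable Q) : Measurable (adapted T E Q) :=
  ((measCells_backWord (T := T) hE hQ).comp_measurable measurable_subtype_coe).measurable_comp
    fun w => Block.ofList w

/-- The length of a word is the entry time, with the empty word for `∞`; finite entry times are at
least `1`, so there is no clash. -/
theorem refines_adapted : Refines (adapted T E Q) (entryTime T E) := by
  intro w
  by_cases h : ∃ y : E, adapted T E Q y = w
  · obtain ⟨y, rfl⟩ := h
    refine ⟨entryTime T E y, fun y' hy' => ?_⟩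
    have hl : (returnTime T.symm E y').toNat = (returnTime T.symm E y).toNat := by
      rw [← length_backWord (Q := Q), ← length_backWord (Q := Q)]
      exact congrArg List.length hy'
    change returnTime T.symm E y' = returnTime T.symm E y
    rcases Nat.eq_zero_or_pos (returnTime T.symm E y).toNat with h0 | h0
    · rw [returnTime_toNat_eq_zero_iff.1 h0, returnTime_toNat_eq_zero_iff.1 (hl.trans h0)]
    · rw [(toNat_returnTime_eq_iff h0).1 hl, ← (toNat_returnTime_eq_iff h0).1 rfl]
  -- A label that is not attained names the empty cell, which lies in any cell.
  · exact ⟨⊤, fun y hy => absurd ⟨y, hy⟩ h⟩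

end Partition

end AdaptedPartition

end

open AdaptedPartition in
theorem mainTheorem5 {X κ : Type*} [MeasurableSpace X] (μ : Measure X) [IsProbabilityMeasure μ]
    (T : X ≃ᵐ X) (hT : MeasurePreserving T μ μ)
    (E : Set X) (hE : MeasurableSet E) (hsweep : SweepsOut μ T E)
    [Finite κ] [MeasurableSpace κ] [DiscreteMeasurableSpace κ] (Q : X → κ) (hQ : Measurable Q) :
    -- a measurable partition of `E` (with countable alphabet) that refines the entry-time partition
    Measurable (adapted T E Q) ∧
    Refines (adapted T E Q) (entryTime T E) ∧
    -- it has finite static entropy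
    staticEntropy (inducedMeasure μ E) (adapted T E Q) < ∞ ∧
    -- the two processes are finitarily isomorphic
    FinitarilyIsomorphic (processLaw μ T (adaptedExt T E Q))
      (processLaw μ T (hatPartition E Q)) ∧
    -- both limits that define the dynamical entropies exist and are finite
    Tendsto (entropyRate (inducedMeasure μ E) (inducedMap T E) (adapted T E Q)) atTop
      (𝓝 (dynEntropy (inducedMeasure μ E) (inducedMap T E) (adapted T E Q))) ∧
    Tendsto (entropyRate μ T (hatPartition E Q)) atTop
      (𝓝 (dynEntropy μ T (hatPartition E Q))) ∧
    dynEntropy μ T (hatPartition E Q) < ∞ ∧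
    -- the entropy formula
    μ E * dynEntropy (inducedMeasure μ E) (inducedMap T E) (adapted T E Q) =
      dynEntropy μ T (hatPartition E Q) := by
  obtain ⟨h₁, h₂, l₁, l₂, hfin, heq⟩ := exists_tendsto_entropyRate_adapted hT hE hsweep hQ
  have e₁ : dynEntropy (inducedMeasure μ E) (inducedMap T E) (adapted T E Q) = h₁ := l₁.limUnder_eq
  have e₂ : dynEntropy μ T (hatPartition E Q) = h₂ := l₂.limUnder_eq
  rw [e₁, e₂]
  exact ⟨measurable_adapted hE hQ, refines_adapted, staticEntropy_adapted_lt_top hT hE hsweep hQ,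
    finitarilyIsomorphic_adaptedExt hT hE hsweep hQ, l₁, l₂, hfin, heq⟩
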